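/- Let $D$ be a finite set and let $\Gamma$ be a finite set of functions $f : D^{k} \to \{0,1\}$ (each with its own arity $k = k_f$). A map $g : D \to D$ is an endomorphism of $\Gamma$ if for every $f \in \Gamma$ and every $(x_1,\dots,x_k) \in D^{k}$, $f(x_1,\dots,x_k) = 0$ implies $f(g(x_1),\dots,g(x_k)) = 0$; $\Gamma$ is a core if all of its endomorphisms are injective. For a set $\Delta$ of finitary relations on $D$, Min CSP$(\Gamma,\Delta)$ is the following minimisation problem. An instance consists of a finite set $V$ of variables, a sum $\sum_{i=1}^m \rho_i f_i(\mathbf{x}_i)$ with $\rho_i \in \mathbb{Q}_{\ge 0}$, $f_i \in \Gamma$ and $\mathbf{x}_i$ a list of $k_{f_i}$ variables from $V$, and finitely many constraint applications $(\mathbf{y}_j; R_j)$ with $R_j \in \Delta$ and $\mathbf{y}_j$ a list of variables from $V$ of matching length. A solution is a map $\sigma : V \to D$ with $\sigma(\mathbf{y}_j) \in R_j$ for all $j$, and its measure, to be minimised, is $\sum_{i=1}^m \rho_i f_i(\sigma(\mathbf{x}_i))$. Weights are written in binary, as fractions. Write Min CSP$(\Gamma)$ for Min CSP$(\Gamma,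 \emptyset)$, and let $\mathcal{C}_D = \{\{d\} : d \in D\}$ be the set of constant unary relations. A minimisation problem $P$ is polynomial-time reducible to a minimisation problem $Q$ if there are functions $F$ and $G$, computable by Turing machines in polynomial time, such that $F$ maps each instance $I$ of $P$ to an instance $F(I)$ of $Q$ that has a solution whenever $I$ has one, and, for every instance $I$ of $P$ and every optimal solution $s$ of $F(I)$, $G(I,s)$ is an optimal solution of $I$ if $I$ has a solution, and is the answer "unsatisfiable" otherwise. Proposition. If $\Gamma$ is a core, then Min CSP$(\Gamma, \mathcal{C}_D)$ is polynomial-time reducible to Min CSP$(\Gamma)$. -/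

import Mathlib

/-! ## Minimisation problems and polynomial-time reductions -/

/-- `f` is computed by a Turing machine in time polynomial in the length of the encoded input. -/
def PolyTimeComputable {α β A B : Type} (ea : α → List A) (eb : β → List B) (f : α → β) : Prop :=
  Nonempty (Turing.TM2ComputableInPolyTime ea eb f)

/-- A minimisation problem: instances, candidate solutions of each instance, the candidates that
are solutions, their measure, and encodings of instances and candidates as words. -/
structure MinProblem where
  /-- instances -/
  Inst : Type
  /-- candidate solutions of an instance -/
  Cand : Inst → Type
  /-- the candidates that are solutions -/
  IsSol : (I : Inst) → Cand I → Prop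
  /-- the measure of a candidate -/
  measure : (I : Inst) → Cand I → ℚ≥0
  /-- alphabet of the instance encoding -/
  InstSym : Type
  /-- alphabet of the solution encoding -/
  SolSym : Type
  /-- encoding of instances -/
  encInst : Inst → List InstSym
  /-- encoding of candidate solutions -/
  encCand : (I : Inst) → Cand I → List SolSym
  encInst_injective : Function.Injective encInst
  encCand_injective : ∀ I, Function.Injective (encCand I)

namespace MinProblem

/-- The instance has a solution. -/
def Satisfiable (P : MinProblem) (I : P.Inst) : Prop := ∃ s, P.IsSol I s

/-- `s` is a solution of minimum measure. -/
def IsOptSol (P : MinProblem) (I : P.Inst) (s : P.Cand I) : Prop :=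
  P.IsSol I s ∧ ∀ t, P.IsSol I t → P.measure I s ≤ P.measure I t

/-- The word written for an answer to `I`: a candidate solution, or `none` for "unsatisfiable". -/
def encAnswer (P : MinProblem) : (Σ I : P.Inst, Option (P.Cand I)) → List (Option P.SolSym)
  | ⟨_, none⟩ => [none]
  | ⟨I, some s⟩ => (P.encCand I s).map some

/-- The word written for an instance of `P` together with a candidate solution of its image under
`f`. -/
def encPair (P Q : MinProblem) (f : P.Inst → Q.Inst) (p : Σ I : P.Inst, Q.Cand (f I)) :
    List (P.InstSym ⊕ Q.SolSym) :=
  (P.encInst p.1).map Sum.inl ++ (Q.encCand (f p.1) p.2).map Sum.inr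

/-- `P` is polynomial-time reducible to `Q`: a polynomial-time computable `f` maps instances of `P`
to instances of `Q`, satisfiable ones to satisfiable ones, and a polynomial-time computable `g`
turns an instance `I` of `P` and any optimal solution of `f I` into an optimal solution of `I`, or
into the answer "unsatisfiable" if `I` has no solution. -/
def PolyTimeReducible (P Q : MinProblem) : Prop :=
  ∃ (f : P.Inst → Q.Inst) (g : (I : P.Inst) → Q.Cand (f I) → Option (P.Cand I)),
    PolyTimeComputable P.encInst Q.encInst f ∧
    PolyTimeComputable (encPair P Q f) P.encAnswer (fun p => ⟨p.1, g p.1 p.2⟩) ∧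
    ∀ I : P.Inst,
      (P.Satisfiable I → Q.Satisfiable (f I)) ∧
      ∀ s : Q.Cand (f I), Q.IsOptSol (f I) s →
        (P.Satisfiable I → ∃ t, g I s = some t ∧ P.IsOptSol I t) ∧
        (¬ P.Satisfiable I → g I s = none)

end MinProblem

/-! ## Min CSP -/

/-- A `{0,1}`-valued function `D ^ k → {0,1}`, with its arity `k`. -/
abbrev CostFn (D : Type) : Type := Σ k : ℕ, (Fin k → D) → Fin 2

/-- A finitary relation on `D`, with its arity. -/
abbrev FinRel (D : Type) : Type := Σ k : ℕ, Set (Fin k → D)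

/-- The set of constant unary relations `{d}`, `d ∈ D`. -/
def constRels (D : Type) : Set (FinRel D) :=
  Set.range fun d : D => (⟨1, {x | x 0 = d}⟩ : FinRel D)

/-- A map `g : D → D` is an endomorphism of `h` if `h x = 0` implies `h (g ∘ x) = 0`. -/
def IsEndo {D : Type} (h : CostFn D) (g : D → D) : Prop :=
  ∀ x : Fin h.1 → D, h.2 x = 0 → h.2 (g ∘ x) = 0

/-- All endomorphisms of `Γ` are injective. -/
def IsCore {D : Type} (Γ : Set (CostFn D)) : Prop :=
  ∀ g : D → D, (∀ h ∈ Γ, IsEndo h g) → Function.Injective g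

/-- A weighted term `ρ f(x)` over the variables `Fin n`. -/
structure CSPTerm {D : Type} (Γ : Set (CostFn D)) (n : ℕ) where
  /-- the weight -/
  weight : ℚ≥0
  /-- the function -/
  fn : Γ
  /-- the list of variables -/
  args : Fin fn.1.1 → Fin n

/-- A constraint application `(y; R)` over the variables `Fin n`. -/
structure CSPConstraint {D : Type} (Δ : Set (FinRel D)) (n : ℕ) where
  /-- the relation -/
  rel : Δ
  /-- the list of variables -/
  args : Fin rel.1.1 → Fin n

/-- An instance of Min CSP(Γ, Δ): variables, a weighted sum, and constraint applications. -/
structure CSPInst {D : Type} (Γ : Set (CostFn D)) (Δ : Set (FinRel D)) where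
  /-- the number of variables -/
  numVars : ℕ
  /-- the terms of the sum -/
  terms : List (CSPTerm Γ numVars)
  /-- the constraint applications -/
  constraints : List (CSPConstraint Δ numVars)

/-- The alphabet in which instances are written: one symbol for each function of `Γ` and each
relation of `Δ`, binary digits, a tick, and a separator. -/
inductive CSPSym {D : Type} (Γ : Set (CostFn D)) (Δ : Set (FinRel D)) : Type
  | fn (f : Γ)
  | rel (R : Δ)
  | bit (b : Bool)
  | tick
  | sep

namespace CSPInst

variable {D : Type} {Γ : Set (CostFn D)} {Δ : Set (FinRel D)}

/-- The assignment satisfies every constraint application. -/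
def IsSol (I : CSPInst Γ Δ) (σ : Fin I.numVars → D) : Prop :=
  ∀ c ∈ I.constraints, (fun i => σ (c.args i)) ∈ c.rel.1.2

/-- The weighted sum of the instance at the assignment `σ`. -/
def measure (I : CSPInst Γ Δ) (σ : Fin I.numVars → D) : ℚ≥0 :=
  (I.terms.map fun t => t.weight * ((t.fn.1.2 fun i => σ (t.args i)).val : ℚ≥0)).sum

/-- A natural number in binary, least significant digit first. -/
def encNat (m : ℕ) : List (CSPSym Γ Δ) := m.bits.map CSPSym.bit

/-- A list of variables, each preceded by a separator. The variables `0, …, n - 1` are written in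
unary; as the whole set of variables is listed in the instance, this is polynomially equivalent to
writing them in binary. -/
def encArgs {n : ℕ} (l : List (Fin n)) : List (CSPSym Γ Δ) :=
  l.flatMap fun v => CSPSym.sep :: List.replicate v.val CSPSym.tick

/-- A term: the function, the numerator and the denominator of the weight in binary, and the
variables. -/
def encTerm {n : ℕ} (t : CSPTerm Γ n) : List (CSPSym Γ Δ) :=
  CSPSym.fn t.fn :: (encNat t.weight.num ++ CSPSym.sep ::
    (encNat t.weight.den ++ encArgs (List.ofFn t.args)))

/-- A constraint application: the relation and the variables. -/
def encConstraint {n : ℕ} (c : CSPConstraint Δ n) : List (CSPSym Γ Δ) :=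
  CSPSym.rel c.rel :: encArgs (List.ofFn c.args)

/-- An instance: one tick for each variable, then the terms, then the constraint applications. -/
def enc (I : CSPInst Γ Δ) : List (CSPSym Γ Δ) :=
  List.replicate I.numVars CSPSym.tick ++ (I.terms.flatMap encTerm ++
    I.constraints.flatMap encConstraint)

/-! ### The encoding is injective -/

/-- Words without a letter satisfying `p`, followed by a word that is empty or starts with such a
letter, can be split uniquely. -/
theorem split_unique {A : Type} (p : A → Prop) {t t' r r' : List A}
    (ht : ∀ a ∈ t, ¬ p a) (ht' : ∀ a ∈ t', ¬ p a)
    (hr : ∀ a ∈ r.head?, p a) (hr' : ∀ a ∈ r'.head?, p a)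
    (h : t ++ r = t' ++ r') : t = t' ∧ r = r' := by
  induction t generalizing t' with
  | nil =>
    cases t' with
    | nil => exact ⟨rfl, h⟩
    | cons a t' =>
      simp only [List.nil_append] at h
      subst h
      exact absurd (hr a (by simp)) (ht' a (by simp))
  | cons a t ih =>
    cases t' with
    | nil =>
      simp only [List.nil_append] at h
      subst h
      exact absurd (hr' a (by simp)) (ht a (by simp))
    | cons b t' =>
      simp only [List.cons_append, List.cons.injEq] at h
      obtain ⟨rfl, h⟩ := h
      obtain ⟨rfl, rfl⟩ := ih (fun a ha => ht a (by simp [ha])) (fun a ha => ht' a (by simp [ha])) h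
      exact ⟨rfl, rfl⟩

/-- A concatenation of nonempty blocks whose first letter, and no other, satisfies `p` can be split
uniquely. -/
theorem flatMap_unique {A X : Type} (p : A → Prop) (e : X → List A)
    (he : ∀ x, ∃ a t, e x = a :: t ∧ p a ∧ ∀ b ∈ t, ¬ p b) (hinj : Function.Injective e)
    {l l' : List X} (h : l.flatMap e = l'.flatMap e) : l = l' := by
  have hd : ∀ l : List X, ∀ a ∈ (l.flatMap e).head?, p a := by
    intro l a ha
    cases l with
    | nil => simp at ha
    | cons x l =>
      obtain ⟨b, t, hb, hp, -⟩ := he x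
      simp only [List.flatMap_cons, hb, List.cons_append, List.head?_cons, Option.mem_def,
        Option.some.injEq] at ha
      exact ha ▸ hp
  induction l generalizing l' with
  | nil =>
    cases l' with
    | nil => rfl
    | cons x l' =>
      obtain ⟨b, t, hb, -⟩ := he x
      simp [hb] at h
  | cons x l ih =>
    cases l' with
    | nil =>
      obtain ⟨b, t, hb, -⟩ := he x
      simp [hb] at h
    | cons y l' =>
      obtain ⟨b, t, hb, -, ht⟩ := he x
      obtain ⟨c, u, hc, -, hu⟩ := he y
      simp only [List.flatMap_cons, hb, hc, List.cons_append, List.cons.injEq] at h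
      obtain ⟨rfl, h⟩ := h
      obtain ⟨rfl, h2⟩ := split_unique p ht hu (hd l) (hd l') h
      rw [hinj (hb.trans hc.symm), ih h2]

theorem encNat_injective : Function.Injective (encNat : ℕ → List (CSPSym Γ Δ)) := by
  intro a b h
  have hb : a.bits = b.bits :=
    (List.map_injective_iff.2 fun x y hxy => CSPSym.bit.inj hxy) h
  have key : ∀ n : ℕ, n.bits.foldr Nat.bit 0 = n := by
    intro n
    induction n using Nat.binaryRec' with
    | zero => simp
    | bit b n hn ih => rw [Nat.bits_append_bit n b hn]; simp [ih]
  rw [← key a, ← key b, hb]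

theorem encArgs_injective {n : ℕ} :
    Function.Injective (encArgs : List (Fin n) → List (CSPSym Γ Δ)) := by
  intro l l' h
  refine flatMap_unique (fun a => a = CSPSym.sep) _ ?_ ?_ h
  · intro v
    refine ⟨_, _, rfl, rfl, ?_⟩
    intro b hb
    rw [List.eq_of_mem_replicate hb]
    simp
  · intro v w hvw
    have := congrArg List.length hvw
    simp at this
    exact Fin.ext this

theorem encArgs_head {n : ℕ} (l : List (Fin n)) :
    ∀ a ∈ (encArgs l : List (CSPSym Γ Δ)).head?, a = CSPSym.sep := by
  cases l <;> simp [encArgs]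

theorem encNat_ne_sep (m : ℕ) : ∀ a ∈ (encNat m : List (CSPSym Γ Δ)), ¬ a = CSPSym.sep := by
  intro a ha
  simp only [encNat, List.mem_map] at ha
  obtain ⟨b, -, rfl⟩ := ha
  simp

theorem encTerm_injective {n : ℕ} :
    Function.Injective (encTerm : CSPTerm Γ n → List (CSPSym Γ Δ)) := by
  rintro ⟨w, f, x⟩ ⟨w', f', x'⟩ h
  simp only [encTerm, List.cons.injEq, CSPSym.fn.injEq] at h
  obtain ⟨rfl, h⟩ := h
  obtain ⟨h1, h⟩ := split_unique (fun a => a = CSPSym.sep) (encNat_ne_sep _) (encNat_ne_sep _)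
    (by simp) (by simp) h
  simp only [List.cons.injEq, true_and] at h
  obtain ⟨h2, h3⟩ := split_unique (fun a => a = CSPSym.sep) (encNat_ne_sep _) (encNat_ne_sep _)
    (encArgs_head _) (encArgs_head _) h
  obtain rfl := NNRat.ext_num_den (encNat_injective h1) (encNat_injective h2)
  obtain rfl := List.ofFn_injective (encArgs_injective h3)
  rfl

theorem encConstraint_injective {n : ℕ} :
    Function.Injective (encConstraint : CSPConstraint Δ n → List (CSPSym Γ Δ)) := by
  rintro ⟨R, x⟩ ⟨R', x'⟩ h
  simp only [encConstraint, List.cons.injEq, CSPSym.rel.injEq] at h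
  obtain ⟨rfl, h⟩ := h
  obtain rfl := List.ofFn_injective (encArgs_injective h)
  rfl

/-- The letters that start a term or a constraint application. -/
def IsHead (a : CSPSym Γ Δ) : Prop := (∃ f, a = CSPSym.fn f) ∨ ∃ R, a = CSPSym.rel R

theorem not_isHead_of_mem_encArgs {n : ℕ} (l : List (Fin n)) :
    ∀ a ∈ (encArgs l : List (CSPSym Γ Δ)), ¬ IsHead a := by
  intro a ha
  simp only [encArgs, List.mem_flatMap, List.mem_cons, List.mem_replicate] at ha
  obtain ⟨v, -, rfl | ⟨-, rfl⟩⟩ := ha <;> simp [IsHead]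

theorem not_isHead_of_mem_encNat (m : ℕ) :
    ∀ a ∈ (encNat m : List (CSPSym Γ Δ)), ¬ IsHead a := by
  intro a ha
  simp only [encNat, List.mem_map] at ha
  obtain ⟨b, -, rfl⟩ := ha
  simp [IsHead]

/-- A term or a constraint application. -/
def encItem {n : ℕ} : CSPTerm Γ n ⊕ CSPConstraint Δ n → List (CSPSym Γ Δ)
  | Sum.inl t => encTerm t
  | Sum.inr c => encConstraint c

theorem encItem_shape {n : ℕ} (x : CSPTerm Γ n ⊕ CSPConstraint Δ n) :
    ∃ a t, encItem x = a :: t ∧ IsHead a ∧ ∀ b ∈ t, ¬ IsHead b := by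
  cases x with
  | inl t =>
    refine ⟨_, _, rfl, Or.inl ⟨_, rfl⟩, ?_⟩
    intro b hb
    simp only [List.mem_append, List.mem_cons] at hb
    rcases hb with hb | rfl | hb | hb
    · exact not_isHead_of_mem_encNat _ b hb
    · simp [IsHead]
    · exact not_isHead_of_mem_encNat _ b hb
    · exact not_isHead_of_mem_encArgs _ b hb
  | inr c => exact ⟨_, _, rfl, Or.inr ⟨_, rfl⟩, not_isHead_of_mem_encArgs _⟩

theorem encItem_injective {n : ℕ} :
    Function.Injective (encItem : CSPTerm Γ n ⊕ CSPConstraint Δ n → List (CSPSym Γ Δ)) := by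
  rintro (t | c) (t' | c') h
  · exact congrArg _ (encTerm_injective h)
  · simp [encItem, encTerm, encConstraint] at h
  · simp [encItem, encTerm, encConstraint] at h
  · exact congrArg _ (encConstraint_injective h)

theorem enc_eq (I : CSPInst Γ Δ) :
    enc I = List.replicate I.numVars CSPSym.tick ++
      (I.terms.map Sum.inl ++ I.constraints.map Sum.inr).flatMap encItem := by
  simp [enc, List.flatMap_append, List.flatMap_map, encItem]

theorem enc_injective : Function.Injective (enc : CSPInst Γ Δ → List (CSPSym Γ Δ)) := by
  have hd : ∀ {n : ℕ} (l : List (CSPTerm Γ n ⊕ CSPConstraint Δ n)),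
      ∀ a ∈ (l.flatMap encItem).head?, IsHead a := by
    intro n l a ha
    cases l with
    | nil => simp at ha
    | cons x l =>
      obtain ⟨b, t, hb, hp, -⟩ := encItem_shape x
      simp only [List.flatMap_cons, hb, List.cons_append, List.head?_cons, Option.mem_def,
        Option.some.injEq] at ha
      exact ha ▸ hp
  have ht : ∀ n : ℕ, ∀ a ∈ List.replicate n (CSPSym.tick : CSPSym Γ Δ), ¬ IsHead a := by
    intro n a ha
    rw [List.eq_of_mem_replicate ha]
    simp [IsHead]
  rintro ⟨n, T, C⟩ ⟨n', T', C'⟩ h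
  rw [enc_eq, enc_eq] at h
  obtain ⟨h1, h⟩ := split_unique IsHead (ht _) (ht _) (hd _) (hd _) h
  have hn : n = n' := by simpa using congrArg List.length h1
  subst hn
  have h2 := flatMap_unique IsHead encItem encItem_shape encItem_injective h
  have hT : T = T' := by
    simpa [List.filterMap_append, List.filterMap_map, Function.comp_def] using
      congrArg (List.filterMap Sum.getLeft?) h2
  have hC : C = C' := by
    simpa [List.filterMap_append, List.filterMap_map, Function.comp_def] using
      congrArg (List.filterMap Sum.getRight?) h2
  rw [hT, hC]

end CSPInst

/-- The problem Min CSP(Γ, Δ). An assignment is written as the word of its values. -/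
def MinCSPWith {D : Type} (Γ : Set (CostFn D)) (Δ : Set (FinRel D)) : MinProblem where
  Inst := CSPInst Γ Δ
  Cand I := Fin I.numVars → D
  IsSol := CSPInst.IsSol
  measure := CSPInst.measure
  InstSym := CSPSym Γ Δ
  SolSym := D
  encInst := CSPInst.enc
  encCand _ σ := List.ofFn σ
  encInst_injective := CSPInst.enc_injective
  encCand_injective _ := List.ofFn_injective

/-- The problem Min CSP(Γ): no constraint applications. -/
def MinCSP {D : Type} (Γ : Set (CostFn D)) : MinProblem := MinCSPWith Γ ∅

/-! Give every element e of D a fresh variable y_e. For each f in Γ and each tuple x with f(x) = 0,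
add the term w·f(y_{x₁}, …, y_{x_k}). If w ≠ 0, these terms all vanish at an assignment s exactly
when g : e ↦ s(y_e) is an endomorphism. A constraint (v; {d}) is replaced by a further copy of these
terms in which v stands in for y_d; it vanishes exactly when g', which agrees with g off d and has
g'(d) = s(v), is an endomorphism. In a core both maps are injective. As D is finite, g is onto, so
s(v) = g(e) for some e, and e ≠ d would give g'(e) = g'(d). Hence s(v) = g(d): the constraints hold
up to the permutation g.

Composing with g⁻¹ removes the permutation. It is a power of g, hence an endomorphism, and an
endomorphism cannot raise the measure because values are 0 or 1 and weights are nonnegative.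
Conversely, a solution σ extends by y_e ↦ e to an assignment of the same measure. The weight w =
2^L, with L the length of the written instance, exceeds every measure, so if a solution exists, an
optimal s makes every gadget vanish (`gadgets_eq_zero_of_measure_lt`) and g⁻¹ ∘ s is optimal
(`reduction_correct`). Testing whether g⁻¹ ∘ s satisfies the constraints settles satisfiability.

For polynomial time, structured stack programs are compiled to machines (`Run.evalsTo`,
`StackProg.polyTimeComputable`). D and Γ are fixed, so a gadget has a constant number of terms and
the map g fits in the finite register; 2^L is written as L zeros and a one. `enc_reduceInst` shows
that the reduced instance can be written token by token, and `run_recoverProg` computes the answer.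
-/

open Function

/-! ## A structured programming language for stack machines -/

/-- Structured programs acting on stacks with alphabets `Γ` and a register with values in `σ`. -/
inductive StackProg {K : Type} (Γ : K → Type) (σ : Type) : Type
  /-- push the letter `a` on the stack `k` -/
  | push (k : K) (a : Γ k)
  /-- apply `f` to the register -/
  | load (f : σ → σ)
  /-- run two programs in succession -/
  | seq (p q : StackProg Γ σ)
  /-- run the program selected by the register -/
  | case (p : σ → StackProg Γ σ)
  /-- pop a letter from the stack `k` and run the program selected by it -/
  | pop (k : K) (p : Option (Γ k) → StackProg Γ σ)
  /-- until the stack `k` is empty, pop a letter and run the program selected by it -/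
  | forEach (k : K) (p : Γ k → StackProg Γ σ)

namespace StackProg

variable {K : Type} {Γ : K → Type} {σ : Type}

/-- The labels of the machine that runs a program. -/
def Lbl : StackProg Γ σ → Type
  | push _ _ => Unit
  | load _ => Unit
  | seq p q => p.Lbl ⊕ q.Lbl
  | case p => Option (Σ v, (p v).Lbl)
  | pop _ p => Option (Σ a, (p a).Lbl)
  | forEach _ p => Option (Σ a, (p a).Lbl)

/-- The label at which a program starts. -/
def entry : (p : StackProg Γ σ) → p.Lbl
  | push _ _ => ()
  | load _ => ()
  | seq p _ => Sum.inl p.entry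
  | case _ => none
  | pop _ _ => none
  | forEach _ _ => none

theorem finite_lbl [Finite σ] [∀ k, Finite (Γ k)] (p : StackProg Γ σ) : Finite p.Lbl := by
  induction p with
  | push | load => exact inferInstanceAs (Finite Unit)
  | seq p q ihp ihq => exact inferInstanceAs (Finite (p.Lbl ⊕ q.Lbl))
  | case p ih => exact inferInstanceAs (Finite (Option (Σ v, (p v).Lbl)))
  | pop k p ih => exact inferInstanceAs (Finite (Option (Σ a, (p a).Lbl)))
  | forEach k p ih => exact inferInstanceAs (Finite (Option (Σ a, (p a).Lbl)))

variable [DecidableEq K]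

/-- The letter of the stack `k` held in the machine register, if there is one. -/
def heldLetter (k : K) (s : Option (Σ k, Γ k)) : Option (Γ k) :=
  s.bind fun a => if h : a.1 = k then some (h ▸ a.2) else none

theorem heldLetter_map (k : K) (a : Option (Γ k)) : heldLetter k (a.map (Sigma.mk k)) = a := by
  cases a <;> simp [heldLetter]

/-- The statement executed at each label; `e` places the labels of the program among all labels,
and `x` is the label at which to continue afterwards. The register of the machine is extended by
the letter popped last. -/
def code {Λ : Type} : (p : StackProg Γ σ) → (p.Lbl → Λ) → Λ → p.Lbl →
    Turing.TM2.Stmt Γ Λ (σ × Option (Σ k, Γ k))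
  | push k a, _, x, _ => .push k (fun _ => a) (.goto fun _ => x)
  | load f, _, x, _ => .load (fun v => (f v.1, v.2)) (.goto fun _ => x)
  | seq p q, e, _, .inl l => p.code (fun l => e (.inl l)) (e (.inr q.entry)) l
  | seq _ q, e, x, .inr l => q.code (fun l => e (.inr l)) x l
  | case p, e, _, none => .goto fun v => e (some ⟨v.1, (p v.1).entry⟩)
  | case p, e, x, some ⟨v, l⟩ => (p v).code (fun l => e (some ⟨v, l⟩)) x l
  | pop k p, e, _, none => .pop k (fun v a => (v.1, a.map (Sigma.mk k)))
      (.goto fun v => e (some ⟨heldLetter k v.2, (p (heldLetter k v.2)).entry⟩))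
  | pop _ p, e, x, some ⟨a, l⟩ => (p a).code (fun l => e (some ⟨a, l⟩)) x l
  | forEach k p, e, x, none => .pop k (fun v a => (v.1, a.map (Sigma.mk k)))
      (.goto fun v => (heldLetter k v.2).elim x fun a => e (some ⟨a, (p a).entry⟩))
  -- The exit label of the body is the head of the loop, not the exit label of the loop.
  | forEach _ p, e, _, some ⟨a, l⟩ => (p a).code (fun l => e (some ⟨a, l⟩)) (e none) l

/-- `Run p v S t v' S'`: started with register `v` and stacks `S`, the program `p` ends with
register `v'` and stacks `S'` after at most `t` steps. -/
inductive Run : StackProg Γ σ → σ → (∀ k, List (Γ k)) → ℕ → σ → (∀ k, List (Γ k)) → Prop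
  | push {k a v S} : Run (push k a) v S 1 v (update S k (a :: S k))
  | load {f v S} : Run (load f) v S 1 (f v) S
  | seq {p q v S t v' S' t' v'' S''} : Run p v S t v' S' → Run q v' S' t' v'' S'' →
      Run (seq p q) v S (t + t') v'' S''
  | case {p v S t v' S'} : Run (p v) v S t v' S' → Run (case p) v S (t + 1) v' S'
  | pop {k p v S t v' S'} : Run (p (S k).head?) v (update S k (S k).tail) t v' S' →
      Run (pop k p) v S (t + 1) v' S'
  | forEach_nil {k p v S} : S k = [] → Run (forEach k p) v S 1 v S
  | forEach_cons {k p v S a l t v' S' t' v'' S''} : S k = a :: l →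
      Run (p a) v (update S k l) t v' S' → Run (forEach k p) v' S' t' v'' S'' →
      Run (forEach k p) v S (t + t' + 1) v'' S''
  -- Weakening of the time bound is built in, so that runs can be combined with convenient bounds
  -- instead of exact step counts.
  | mono {p v S t v' S' t'} : Run p v S t v' S' → t ≤ t' → Run p v S t' v' S'

/-! ### Simulation of structured programs by multi-stack Turing machines -/

section Compile

open StateTransition Turing

variable {Λ : Type}

theorem evalsTo_of_step {X : Type} {f : X → Option X} {a b : X} {c : Option X} {t : ℕ}
    (h : f a = some b) (hb : Nonempty (EvalsToInTime f b c t)) :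
    Nonempty (EvalsToInTime f a c (t + 1)) :=
  hb.map fun hb => EvalsToInTime.trans f 1 t a b c ⟨⟨1, h⟩, le_rfl⟩ hb

/-- Transport of an evaluation along equalities. -/
def EvalsToInTime.cast {X : Type} {f : X → Option X} {a a' : X} {b b' : Option X} {t t' : ℕ}
    (h : EvalsToInTime f a b t) (ha : a = a') (hb : b = b') (ht : t = t') :
    EvalsToInTime f a' b' t' :=
  ⟨⟨h.steps, by rw [← ha, ← hb]; exact h.evals_in_steps⟩, h.steps_le_m.trans ht.le⟩

theorem step_eq_of_code {X : Type} {M : Λ → TM2.Stmt Γ Λ X} {l : Λ} {q : TM2.Stmt Γ Λ X}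
    (h : M l = q) (v : X) (S : ∀ k, List (Γ k)) :
    TM2.step M ⟨some l, v, S⟩ = some (TM2.stepAux q v S) := by
  subst h
  rfl

/-- The machine simulates a run of a program. -/
theorem Run.evalsTo {p : StackProg Γ σ} {v S t v' S'} (h : Run p v S t v' S')
    (M : Λ → TM2.Stmt Γ Λ (σ × Option (Σ k, Γ k))) (e : p.Lbl → Λ) (x : Λ)
    (hM : ∀ l, M (e l) = p.code e x l) (j : Option (Σ k, Γ k)) :
    ∃ j', Nonempty (EvalsToInTime (TM2.step M) ⟨some (e p.entry), (v, j), S⟩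
      (some ⟨some x, (v', j'), S'⟩) t) := by
  induction h generalizing x j with
  | push => exact ⟨j, evalsTo_of_step (t := 0) (step_eq_of_code (hM ()) _ _) ⟨.refl _ _⟩⟩
  | load => exact ⟨j, evalsTo_of_step (t := 0) (step_eq_of_code (hM ()) _ _) ⟨.refl _ _⟩⟩
  | @seq p q _ _ _ _ _ _ _ _ _ _ ih₁ ih₂ =>
    obtain ⟨j₁, ⟨h₁⟩⟩ := ih₁ (fun l => e (.inl l)) (e (.inr q.entry)) (fun l => hM (.inl l)) j
    obtain ⟨j₂, ⟨h₂⟩⟩ := ih₂ (fun l => e (.inr l)) x (fun l => hM (.inr l)) j₁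
    exact ⟨j₂, ⟨by rw [add_comm]; exact EvalsToInTime.trans _ _ _ _ _ _ h₁ h₂⟩⟩
  | @case p v _ _ _ _ _ ih =>
    obtain ⟨j₁, h₁⟩ := ih (fun l => e (some ⟨v, l⟩)) x (fun l => hM (some ⟨v, l⟩)) j
    exact ⟨j₁, evalsTo_of_step (step_eq_of_code (hM none) _ _) h₁⟩
  | @pop k p v S _ _ _ _ ih =>
    obtain ⟨j₁, h₁⟩ := ih (fun l => e (some ⟨_, l⟩)) x (fun l => hM (some ⟨_, l⟩))
      ((S k).head?.map (Sigma.mk k))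
    refine ⟨j₁, evalsTo_of_step ((step_eq_of_code (hM none) _ _).trans ?_) h₁⟩
    exact congrArg (fun a => some (TM2.Cfg.mk (some (e (some ⟨a, (p a).entry⟩)))
      (v, (S k).head?.map (Sigma.mk k)) (update S k (S k).tail))) (heldLetter_map k _)
  | @forEach_nil k p v S hS =>
    -- Popping the empty stack leaves no held letter, whatever `j` was.
    refine ⟨none, evalsTo_of_step (t := 0) ((step_eq_of_code (hM none) _ _).trans ?_)
      ⟨.refl _ _⟩⟩
    have : update S k [] = S := by rw [← hS, update_eq_self]
    simp [code, hS, heldLetter, this]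
  | @forEach_cons k p v S a l _ _ _ _ _ _ hS _ _ ih₁ ih₂ =>
    obtain ⟨j₁, ⟨h₁⟩⟩ := ih₁ (fun l => e (some ⟨a, l⟩)) (e none) (fun l => hM (some ⟨a, l⟩))
      (some ⟨k, a⟩)
    obtain ⟨j₂, ⟨h₂⟩⟩ := ih₂ e x hM j₁
    refine ⟨j₂, evalsTo_of_step ((step_eq_of_code (hM none) _ _).trans ?_)
      ⟨by rw [add_comm]; exact EvalsToInTime.trans _ _ _ _ _ _ h₁ h₂⟩⟩
    simp [code, hS, heldLetter]
  | mono _ hle ih =>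
    obtain ⟨j₁, ⟨h₁⟩⟩ := ih e x hM j
    exact ⟨j₁, ⟨⟨h₁.toEvalsTo, h₁.steps_le_m.trans hle⟩⟩⟩

theorem initList_eq (tm : FinTM2) (s : List (tm.Γ tm.k₀)) :
    initList tm s = ⟨some tm.main, tm.initialState, update (fun _ => []) tm.k₀ s⟩ := by
  unfold initList
  congr 1
  funext k
  by_cases hk : k = tm.k₀
  · subst hk
    simp
  · simp [hk]

theorem haltList_eq (tm : FinTM2) (s : List (tm.Γ tm.k₁)) :
    haltList tm s = ⟨none, tm.initialState, update (fun _ => []) tm.k₁ s⟩ := by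
  unfold haltList
  congr 1
  funext k
  by_cases hk : k = tm.k₁
  · subst hk
    simp
  · simp [hk]

/-- The machine that runs the program `p` and halts. -/
noncomputable def toFinTM2 [Fintype K] [Finite σ] [∀ k, Finite (Γ k)] (p : StackProg Γ σ)
    (k₀ k₁ : K) (v₀ : σ) : FinTM2 where
  K := K
  k₀ := k₀
  k₁ := k₁
  Γ := Γ
  Λ := Option p.Lbl
  main := some p.entry
  ΛFin := by
    haveI := p.finite_lbl
    exact Fintype.ofFinite _
  σ := σ × Option (Σ k, Γ k)
  initialState := (v₀, none)
  σFin := Fintype.ofFinite _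
  Γk₀Fin := Fintype.ofFinite _
  m
    | none => .load (fun v => (v.1, none)) .halt
    | some l => p.code some none l

/-- A function computed by a structured program in polynomial time is computable by a Turing
machine in polynomial time. -/
theorem polyTimeComputable [Fintype K] [Finite σ] [∀ k, Finite (Γ k)] (p : StackProg Γ σ)
    (k₀ k₁ : K) (v₀ : σ) {α β : Type} (ea : α → List (Γ k₀)) (eb : β → List (Γ k₁)) (f : α → β)
    (time : Polynomial ℕ)
    (h : ∀ a, Run p v₀ (update (fun _ => []) k₀ (ea a)) (time.eval (ea a).length) v₀
      (update (fun _ => []) k₁ (eb (f a)))) :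
    PolyTimeComputable ea eb f := by
  refine ⟨⟨⟨p.toFinTM2 k₀ k₁ v₀, Equiv.refl _, Equiv.refl _⟩, time + 1, fun a => ?_⟩⟩
  -- The time bound is data, whereas `Run.evalsTo` only yields its existence.
  refine Classical.choice ?_
  obtain ⟨j, ⟨h₁⟩⟩ := (h a).evalsTo (p.toFinTM2 k₀ k₁ v₀).m some none (fun l => rfl) none
  -- One more step forgets the letter popped last: a halting configuration must have the initial
  -- state, and this is also why programs must restore `v₀`.
  have hlast : EvalsToInTime (TM2.step (p.toFinTM2 k₀ k₁ v₀).m)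
      (⟨some none, (v₀, j), update (fun _ => []) k₁ (eb (f a))⟩ :
        TM2.Cfg Γ (Option p.Lbl) (σ × Option (Σ k, Γ k)))
      (some ⟨none, (v₀, none), update (fun _ => []) k₁ (eb (f a))⟩) 1 := ⟨⟨1, rfl⟩, le_rfl⟩
  have := EvalsToInTime.trans _ _ _ _ _ _ h₁ hlast
  have htime : 1 + time.eval (ea a).length = (time + 1).eval (ea a).length := by
    simp [add_comm]
  have hinit : (⟨some (some p.entry), (v₀, none), update (fun _ => []) k₀ (ea a)⟩ :
        TM2.Cfg Γ (Option p.Lbl) (σ × Option (Σ k, Γ k))) =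
      initList (p.toFinTM2 k₀ k₁ v₀) ((ea a).map id) :=
    ((congrArg (initList (p.toFinTM2 k₀ k₁ v₀)) (List.map_id (ea a))).trans
      (initList_eq _ _)).symm
  have hhalt : (⟨none, (v₀, none), update (fun _ => []) k₁ (eb (f a))⟩ :
        TM2.Cfg Γ (Option p.Lbl) (σ × Option (Σ k, Γ k))) =
      haltList (p.toFinTM2 k₀ k₁ v₀) ((eb (f a)).map id) :=
    ((congrArg (haltList (p.toFinTM2 k₀ k₁ v₀)) (List.map_id (eb (f a)))).trans
      (haltList_eq _ _)).symm
  exact ⟨EvalsToInTime.cast this hinit (congrArg some hhalt) htime⟩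

end Compile

/-! ### Basic programs -/

/-- The program that does nothing. -/
def skip : StackProg Γ σ := load id

theorem Run.skip {v : σ} {S : ∀ k, List (Γ k)} : Run skip v S 1 v S := Run.load

theorem Run.congr {p : StackProg Γ σ} {v S t v' S' t' v'' S''} (h : Run p v S t v' S')
    (ht : t ≤ t') (hv : v' = v'') (hS : S' = S'') : Run p v S t' v'' S'' := by
  subst hv hS
  exact h.mono ht

/-- Push the letters of a word, so that it ends up on top of the stack `k`. -/
def pushWord (k : K) : List (Γ k) → StackProg Γ σ
  | [] => skip
  | a :: l => seq (pushWord k l) (push k a)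

theorem Run.pushWord (k : K) (l : List (Γ k)) (v : σ) (S : ∀ k, List (Γ k)) :
    Run (pushWord k l) v S (l.length + 1) v (update S k (l ++ S k)) := by
  induction l with
  | nil => exact Run.skip.congr (by simp) rfl (by simp)
  | cons a l ih => exact (ih.seq .push).congr (by simp) rfl (by simp)

/-- Empty the stack `k`. -/
def clear (k : K) : StackProg Γ σ := forEach k fun _ => skip

theorem Run.clear (k : K) (v : σ) (S : ∀ k, List (Γ k)) :
    Run (clear k) v S (2 * (S k).length + 1) v (update S k []) := by
  generalize hl : S k = l
  induction l generalizing S with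
  | nil => exact (Run.forEach_nil hl).congr (by simp) rfl (by rw [← hl, update_eq_self])
  | cons a l ih =>
    exact (Run.forEach_cons hl .skip (ih (update S k l) (by simp))).congr
      (by simp; omega) rfl (by simp)

/-- Move the letters of the stack `k`, changed by `f`, to the stack `k'`. -/
def move (k k' : K) (f : Γ k → Γ k') : StackProg Γ σ := forEach k fun a => push k' (f a)

theorem Run.move {k k' : K} (hk : k ≠ k') (f : Γ k → Γ k') (v : σ) (S : ∀ k, List (Γ k)) :
    Run (move k k' f) v S (2 * (S k).length + 1) v
      (update (update S k []) k' (((S k).map f).reverse ++ S k')) := by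
  generalize hl : S k = l
  induction l generalizing S with
  | nil =>
    refine (Run.forEach_nil hl).congr (by simp) rfl ?_
    have : update S k [] = S := by rw [← hl, update_eq_self]
    simp [this]
  | cons a l ih =>
    refine (Run.forEach_cons hl (.push (k := k')) (ih _ (by simp [hk]))).congr (by simp; omega) rfl ?_
    rw [update_comm hk.symm]
    simp [hk.symm]

/-- Push on `out` as many letters `a` as there are letters on the stack `k`, using the empty stack
`tmp`. -/
def pushCopies (k tmp out : K) (f : Γ k → Γ tmp) (f' : Γ tmp → Γ k) (a : Γ out) : StackProg Γ σ :=
  seq (forEach k fun b => seq (push tmp (f b)) (push out a)) (move tmp k f')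

/-- The stack `k` is reversed onto `tmp` while the copies are written, and reversed back afterwards,
so its contents survive. Three steps per letter on the way out and two on the way back give the
factor 5. -/
theorem Run.pushCopies {k tmp out : K} (h₁ : k ≠ tmp) (h₂ : k ≠ out) (h₃ : tmp ≠ out)
    {f : Γ k → Γ tmp} {f' : Γ tmp → Γ k} (hf : LeftInverse f' f) (a : Γ out) (v : σ)
    (S : ∀ k, List (Γ k)) (hS : S tmp = []) :
    Run (pushCopies k tmp out f f' a) v S (5 * (S k).length + 2) v
      (update S out (List.replicate (S k).length a ++ S out)) := by
  have key : ∀ (l : List (Γ k)) (S : ∀ k, List (Γ k)), S k = l →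
      Run (forEach k fun b => .seq (.push tmp (f b)) (.push out a)) v S (3 * l.length + 1) v
        (update (update (update S k []) tmp ((l.map f).reverse ++ S tmp)) out
          (List.replicate l.length a ++ S out)) := by
    intro l
    induction l with
    | nil =>
      intro S hl
      refine (Run.forEach_nil hl).congr (by simp) rfl ?_
      have : update S k [] = S := by rw [← hl, update_eq_self]
      simp [this]
    | cons b l ih =>
      intro S hl
      refine (Run.forEach_cons hl (.seq .push .push) (ih _ (by simp [h₁, h₂]))).congr
        (by simp; omega) rfl ?_
      funext i
      have := List.replicate_append_replicate (n := l.length) (m := 1) (a := a)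
      by_cases hi : i = out
      · subst hi
        simp [h₃.symm, h₂.symm, ← this]
      · by_cases hi' : i = tmp
        · subst hi'
          simp [hi, h₁.symm]
        · by_cases hi'' : i = k
          · subst hi''
            simp [hi, hi']
          · simp [hi, hi', hi'']
  refine ((key _ S rfl).seq (.move h₁.symm f' v _)).congr ?_ rfl ?_
  · simp [h₃, hS]; omega
  · funext i
    by_cases hi : i = out
    · subst hi
      simp [h₂.symm, h₃.symm]
    · by_cases hi' : i = k
      · subst hi'
        simp [hi, h₁, h₃, hS, Function.comp_def, hf _]
      · by_cases hi'' : i = tmp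
        · subst hi''
          simp [hi, hS, hi']
        · simp [hi, hi', hi'']

end StackProg

/-! ## The reduction -/

namespace CoreReduction

variable {D : Type} {Γ : Set (CostFn D)}

/-- The constant `d` of a constant relation `{d}`. -/
noncomputable def constOf (R : constRels D) : D := R.2.choose

theorem constOf_spec (R : constRels D) :
    (⟨1, {x | x 0 = constOf R}⟩ : FinRel D) = R.1 := R.2.choose_spec

/-- The variable of a constraint application of a constant relation. -/
def constVar {n : ℕ} (c : CSPConstraint (constRels D) n) : Fin n :=
  c.args ⟨0, by rw [← constOf_spec]; exact Nat.one_pos⟩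

/-- The form of a constraint application of a constant relation. -/
theorem constraint_cases {n : ℕ} {motive : CSPConstraint (constRels D) n → D → Fin n → Prop}
    (h : ∀ (d : D) (v : Fin n) (hd : (⟨1, {x | x 0 = d}⟩ : FinRel D) ∈ constRels D),
      motive ⟨⟨⟨1, {x | x 0 = d}⟩, hd⟩, fun _ => v⟩ d v)
    (c : CSPConstraint (constRels D) n) : motive c (constOf c.rel) (constVar c) := by
  obtain ⟨R, args⟩ := c
  have hR := constOf_spec R
  simp only [constVar]
  generalize constOf R = d at hR ⊢
  obtain ⟨R, hmem⟩ := R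
  dsimp only at hR
  subst hR
  have : args = fun _ => args ⟨0, Nat.one_pos⟩ := by
    funext i
    congr 1
    exact Subsingleton.elim (α := Fin 1) _ _
  have h' := h d (args ⟨0, Nat.one_pos⟩) hmem
  rw [← this] at h'
  exact h'

theorem mem_rel_iff {n : ℕ} (c : CSPConstraint (constRels D) n) (σ : Fin n → D) :
    (fun i => σ (c.args i)) ∈ c.rel.1.2 ↔ σ (constVar c) = constOf c.rel :=
  constraint_cases (motive := fun c d v => (fun i => σ (c.args i)) ∈ c.rel.1.2 ↔ σ v = d)
    (fun _ _ _ => Iff.rfl) c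

theorem encConstraint_eq {n : ℕ} (c : CSPConstraint (constRels D) n) :
    (CSPInst.encConstraint c : List (CSPSym Γ (constRels D))) =
      CSPSym.rel c.rel :: CSPSym.sep :: List.replicate (constVar c).val CSPSym.tick :=
  constraint_cases (motive := fun c _ v => (CSPInst.encConstraint c : List (CSPSym Γ _)) =
      CSPSym.rel c.rel :: CSPSym.sep :: List.replicate v.val CSPSym.tick)
    (fun d v hd => by simp [CSPInst.encConstraint, CSPInst.encArgs]) c

theorem isSol_iff {I : CSPInst Γ (constRels D)} {σ : Fin I.numVars → D} :
    I.IsSol σ ↔ ∀ c ∈ I.constraints, σ (constVar c) = constOf c.rel :=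
  forall₂_congr fun c _ => mem_rel_iff c σ

/-! ### Endomorphisms and their effect on the measure -/

/-- A left inverse of `g` if `g` is injective. -/
noncomputable def invOrSelf (g : D → D) (a : D) : D :=
  open scoped Classical in if h : ∃ b, g b = a then h.choose else a

theorem invOrSelf_apply {g : D → D} (hg : Injective g) (b : D) : invOrSelf g (g b) = b := by
  have h : ∃ b', g b' = g b := ⟨b, rfl⟩
  rw [invOrSelf, dif_pos h]
  exact hg h.choose_spec

theorem isEndo_id (h : CostFn D) : IsEndo h id := fun _ hx => hx

theorem IsEndo.comp {h : CostFn D} {g g' : D → D} (hg : IsEndo h g) (hg' : IsEndo h g') :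
    IsEndo h (g ∘ g') := fun x hx => hg _ (hg' x hx)

/-- The value of a term at an assignment. -/
def termValue {n : ℕ} (s : Fin n → D) (t : CSPTerm Γ n) : ℚ≥0 :=
  t.weight * ((t.fn.1.2 fun i => s (t.args i)).val : ℚ≥0)

/-- With only the values 0 and 1, preserving zeros is the same as not increasing the value. -/
theorem termValue_le_of_imp {n : ℕ} {s s' : Fin n → D} {t : CSPTerm Γ n}
    (h : (t.fn.1.2 fun i => s (t.args i)) = 0 → (t.fn.1.2 fun i => s' (t.args i)) = 0) :
    termValue s' t ≤ termValue s t := by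
  unfold termValue
  refine mul_le_mul_of_nonneg_left ?_ zero_le
  rw [Nat.cast_le]
  generalize (t.fn.1.2 fun i => s (t.args i)) = a at h ⊢
  generalize (t.fn.1.2 fun i => s' (t.args i)) = b at h ⊢
  by_cases ha : a = 0
  · rw [ha, h ha]
  · omega

theorem measure_le_of_imp {Δ : Set (FinRel D)} {I : CSPInst Γ Δ} {s s' : Fin I.numVars → D}
    (h : ∀ t ∈ I.terms, (t.fn.1.2 fun i => s (t.args i)) = 0 →
      (t.fn.1.2 fun i => s' (t.args i)) = 0) :
    I.measure s' ≤ I.measure s := by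
  change (I.terms.map (termValue s')).sum ≤ (I.terms.map (termValue s)).sum
  generalize I.terms = l at h ⊢
  induction l with
  | nil => simp
  | cons t l ih =>
    rw [List.map_cons, List.map_cons, List.sum_cons, List.sum_cons]
    exact add_le_add (termValue_le_of_imp (h t (by simp))) (ih fun t ht => h t (by simp [ht]))

/-! ### A weight exceeding all measures of the instance -/

/-- The weight of the gadgets. -/
def heavyWeight (I : CSPInst Γ (constRels D)) : ℚ≥0 := 2 ^ I.enc.length

/-- A weight is at most its numerator, which is less than 2 to the number of its binary digits, and
these digits are part of the written term. -/
theorem weight_add_one_le {n : ℕ} (t : CSPTerm Γ n) :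
    t.weight + 1 ≤ 2 ^ (CSPInst.encTerm t : List (CSPSym Γ (constRels D))).length := by
  have h₁ : t.weight ≤ (t.weight.num : ℚ≥0) := by
    conv_lhs => rw [← NNRat.num_div_den t.weight]
    exact div_le_self zero_le (by exact_mod_cast t.weight.den_pos)
  have h₂ : t.weight.num + 1 ≤ 2 ^ (Nat.bits t.weight.num).length := by
    rw [Nat.size_eq_bits_len]
    exact Nat.lt_size_self _
  have h₃ : (Nat.bits t.weight.num).length ≤
      (CSPInst.encTerm t : List (CSPSym Γ (constRels D))).length := by
    simp only [CSPInst.encTerm, CSPInst.encNat, List.length_cons, List.length_append,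
      List.length_map]
    omega
  calc t.weight + 1 ≤ (t.weight.num : ℚ≥0) + 1 := by gcongr
    _ ≤ 2 ^ (Nat.bits t.weight.num).length := by exact_mod_cast h₂
    _ ≤ _ := pow_le_pow_right₀ one_le_two h₃

/-- The sum of the weights plus one is at most the product of the factors (weight + 1). Each factor
is at most 2 to the length of its term, and lengths add up. -/
theorem measure_lt_heavyWeight (I : CSPInst Γ (constRels D)) (σ : Fin I.numVars → D) :
    I.measure σ < heavyWeight I := by
  have key : ∀ l : List (CSPTerm Γ I.numVars), (l.map (termValue σ)).sum + 1 ≤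
      2 ^ (l.flatMap (CSPInst.encTerm (Δ := constRels D))).length := by
    intro l
    induction l with
    | nil => simp
    | cons t l ih =>
      have ht : termValue σ t ≤ t.weight := by
        refine mul_le_of_le_one_right zero_le ?_
        have := (t.fn.1.2 fun i => σ (t.args i)).isLt
        exact_mod_cast Nat.le_of_lt_succ this
      simp only [List.map_cons, List.sum_cons, List.flatMap_cons, List.length_append, pow_add]
      calc termValue σ t + (l.map (termValue σ)).sum + 1
          ≤ t.weight + (l.map (termValue σ)).sum + 1 := by gcongr
        _ ≤ (t.weight + 1) * ((l.map (termValue σ)).sum + 1) := by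
            rw [add_mul, one_mul, mul_add, mul_one]
            rw [add_assoc, add_assoc]
            exact le_add_self
        _ ≤ _ := mul_le_mul' (weight_add_one_le t) ih
  have hlen : (I.terms.flatMap (CSPInst.encTerm (Δ := constRels D))).length ≤ I.enc.length := by
    simp only [CSPInst.enc, List.length_append]
    omega
  have := (key I.terms).trans (pow_le_pow_right₀ (one_le_two (α := ℚ≥0)) hlen)
  exact lt_of_lt_of_le (lt_add_one _) this

theorem isSol_of_constraints_eq_nil {Δ : Set (FinRel D)} {I : CSPInst Γ Δ}
    (h : I.constraints = []) (s : Fin I.numVars → D) : I.IsSol s := by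
  intro c hc
  rw [h] at hc
  simp at hc

variable [Finite D]

/-- An injective `g` on a finite set is a permutation of finite order m, so its inverse is the
iterate `g^[m - 1]`, and endomorphisms are closed under composition. -/
theorem isEndo_invOrSelf {h : CostFn D} {g : D → D} (hg : IsEndo h g) (hinj : Injective g) :
    IsEndo h (invOrSelf g) := by
  have hiter : ∀ k : ℕ, IsEndo h (g^[k]) := by
    intro k
    induction k with
    | zero => exact isEndo_id h
    | succ k ih => rw [iterate_succ]; exact IsEndo.comp ih hg
  let e : Equiv.Perm D := Equiv.ofBijective g (Finite.injective_iff_bijective.1 hinj)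
  have hpos : 0 < orderOf e := orderOf_pos e
  have hpow : g^[orderOf e] = id := by
    have : ⇑(e ^ orderOf e) = id := by rw [pow_orderOf_eq_one, Equiv.Perm.coe_one]
    rwa [Equiv.Perm.coe_pow] at this
  have : invOrSelf g = g^[orderOf e - 1] := by
    funext a
    have ha : g (g^[orderOf e - 1] a) = a := by
      rw [← iterate_succ_apply' g, Nat.succ_eq_add_one, Nat.sub_add_cancel hpos, hpow, id]
    conv_lhs => rw [← ha]
    exact invOrSelf_apply hinj _
  rw [this]
  exact hiter _

/-! ### The gadgets and the correctness of the reduction -/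

/-- An enumeration of the domain. -/
noncomputable def idx : D ≃ Fin (Nat.card D) := Finite.equivFin D

variable (Γ) in
/-- All pairs of a function in `Γ` and a tuple at which it vanishes. -/
noncomputable def zeroTuples [Finite Γ] : List (Σ f : Γ, Fin f.1.1 → D) :=
  (Set.toFinite {p : Σ f : Γ, Fin f.1.1 → D | p.1.1.2 p.2 = 0}).toFinset.toList

theorem mem_zeroTuples [Finite Γ] {p : Σ f : Γ, Fin f.1.1 → D} :
    p ∈ zeroTuples Γ ↔ p.1.1.2 p.2 = 0 := by
  simp [zeroTuples]

/-- The variable that represents the domain element `e`; if `r` is a pair `(d, v)`, the variable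
`v` of the original instance represents `d`. -/
noncomputable def elemVar (n : ℕ) (r : Option (D × Fin n)) (e : D) : Fin (Nat.card D + n) :=
  open scoped Classical in
  r.elim (Fin.castAdd n (idx e)) fun p =>
    if e = p.1 then Fin.natAdd _ p.2 else Fin.castAdd n (idx e)

/-- Terms of weight `w` that vanish if and only if the values of the variables representing the
domain elements define an endomorphism. -/
noncomputable def gadget [Finite Γ] (n : ℕ) (w : ℚ≥0) (r : Option (D × Fin n)) :
    List (CSPTerm Γ (Nat.card D + n)) :=
  (zeroTuples Γ).map fun p => ⟨w, p.1, fun i => elemVar n r (p.2 i)⟩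

/-- A term of the original instance over the extended set of variables. -/
def shiftTerm {n : ℕ} (m : ℕ) (t : CSPTerm Γ n) : CSPTerm Γ (m + n) :=
  ⟨t.weight, t.fn, fun i => Fin.natAdd m (t.args i)⟩

/-- The gadgets for the constraint applications and for the domain itself. -/
noncomputable def gadgets [Finite Γ] (I : CSPInst Γ (constRels D)) :
    List (CSPTerm Γ (Nat.card D + I.numVars)) :=
  (I.constraints.flatMap fun c =>
    gadget I.numVars (heavyWeight I) (some (constOf c.rel, constVar c))) ++
      gadget I.numVars (heavyWeight I) none

/-- The instance without constraint applications. -/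
noncomputable def reduceInst [Finite Γ] (I : CSPInst Γ (constRels D)) : CSPInst Γ ∅ where
  numVars := Nat.card D + I.numVars
  terms := I.terms.map (shiftTerm _) ++ gadgets I
  constraints := []

/-- The assignment of the original instance obtained from one of the reduced instance. -/
noncomputable def pullBack (n : ℕ) (s : Fin (Nat.card D + n) → D) (i : Fin n) : D :=
  invOrSelf (fun e => s (Fin.castAdd n (idx e))) (s (Fin.natAdd _ i))

/-- The answer to the original instance obtained from a solution of the reduced instance. -/
noncomputable def recoverSol (I : CSPInst Γ (constRels D))
    (s : Fin (Nat.card D + I.numVars) → D) : Option (Fin I.numVars → D) :=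
  open scoped Classical in
  if I.IsSol (pullBack _ s) then some (pullBack _ s) else none

theorem measure_reduceInst [Finite Γ] (I : CSPInst Γ (constRels D))
    (s : Fin (Nat.card D + I.numVars) → D) :
    (reduceInst I).measure s = I.measure (fun i => s (Fin.natAdd _ i)) +
      ((gadgets I).map (termValue s)).sum := by
  simp only [CSPInst.measure, reduceInst, List.map_append, List.map_map, List.sum_append]
  rfl

/-- If the gadget vanishes, the variables representing the domain elements define an
endomorphism. -/
theorem isEndo_of_gadget [Finite Γ] {n : ℕ} {w : ℚ≥0} (hw : w ≠ 0) {r : Option (D × Fin n)}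
    {s : Fin (Nat.card D + n) → D} (hs : ∀ t ∈ gadget (Γ := Γ) n w r, termValue s t = 0)
    (h : CostFn D) (hh : h ∈ Γ) : IsEndo h fun e => s (elemVar n r e) := by
  intro x hx
  have := hs ⟨w, ⟨h, hh⟩, fun i => elemVar n r (x i)⟩
    (List.mem_map.2 ⟨⟨⟨h, hh⟩, x⟩, mem_zeroTuples.2 hx, rfl⟩)
  rw [termValue, mul_eq_zero, or_iff_right hw, Nat.cast_eq_zero] at this
  exact Fin.ext this

/-- The gadget vanishes if every domain element is represented by itself. -/
theorem gadget_eq_zero [Finite Γ] {n : ℕ} {w : ℚ≥0} {r : Option (D × Fin n)}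
    {s : Fin (Nat.card D + n) → D} (hs : ∀ e, s (elemVar n r e) = e) :
    ∀ t ∈ gadget (Γ := Γ) n w r, termValue s t = 0 := by
  intro t ht
  obtain ⟨p, hp, rfl⟩ := List.mem_map.1 ht
  simp [termValue, hs, mem_zeroTuples.1 hp]

/-- Under `Fin.append idx.symm σ` the variable of `e` has value `e`. Where `v` replaces the variable
of `d`, this is the constraint σ(v) = d itself. -/
theorem gadgets_of_isSol [Finite Γ] {I : CSPInst Γ (constRels D)} {σ : Fin I.numVars → D}
    (hσ : I.IsSol σ) : ((gadgets I).map (termValue (Fin.append idx.symm σ))).sum = 0 := by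
  refine List.sum_eq_zero ?_
  simp only [List.mem_map, gadgets, List.mem_append, List.mem_flatMap]
  rintro _ ⟨t, ⟨c, hc, ht⟩ | ht, rfl⟩
  · refine gadget_eq_zero (fun e => ?_) t ht
    by_cases he : e = constOf c.rel
    · simpa [elemVar, he] using isSol_iff.1 hσ c hc
    · simp [elemVar, he]
  · exact gadget_eq_zero (fun e => by simp [elemVar]) t ht

theorem measure_append_of_isSol [Finite Γ] {I : CSPInst Γ (constRels D)}
    {σ : Fin I.numVars → D} (hσ : I.IsSol σ) :
    (reduceInst I).measure (Fin.append idx.symm σ) = I.measure σ := by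
  rw [measure_reduceInst, gadgets_of_isSol hσ]
  simp

/-- At an assignment of measure less than the weight of the gadgets, the gadgets vanish. -/
theorem gadgets_eq_zero_of_measure_lt [Finite Γ] {I : CSPInst Γ (constRels D)}
    {s : Fin (Nat.card D + I.numVars) → D} (hs : (reduceInst I).measure s < heavyWeight I) :
    ∀ t ∈ gadgets I, termValue s t = 0 := by
  intro t ht
  by_contra hne
  have hw : t.weight = heavyWeight I := by
    simp only [gadgets, gadget, List.mem_append, List.mem_flatMap, List.mem_map] at ht
    obtain ⟨_, _, _, _, rfl⟩ | ⟨_, _, rfl⟩ := ht <;> rfl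
  -- A term that does not vanish takes the value 1, so it contributes its full weight.
  have h₁ : t.weight ≤ termValue s t := by
    rw [termValue, ← ne_eq, mul_ne_zero_iff] at hne
    refine le_mul_of_one_le_right zero_le ?_
    have : ((t.fn.1.2 fun i => s (t.args i)).val : ℚ≥0) ≠ 0 := hne.2
    exact_mod_cast Nat.one_le_iff_ne_zero.2 (by exact_mod_cast this)
  have h₂ : termValue s t ≤ (reduceInst I).measure s := by
    rw [measure_reduceInst]
    exact (List.single_le_sum (fun _ _ => zero_le) _ (List.mem_map_of_mem ht)).trans
      le_add_self
  exact absurd (hw ▸ h₁.trans h₂) (not_le.2 hs)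

/-- Any solution bounds the optimum below `heavyWeight I`, so all gadgets vanish at `s`. The core
property then applies to the map `g` read off `s` and to its modification for each constraint. -/
theorem reduction_correct [Finite Γ] (hcore : IsCore Γ) {I : CSPInst Γ (constRels D)}
    {s : Fin (Nat.card D + I.numVars) → D}
    (hs : ∀ s', (reduceInst I).measure s ≤ (reduceInst I).measure s')
    (hsat : ∃ σ, I.IsSol σ) :
    I.IsSol (pullBack _ s) ∧ ∀ σ, I.IsSol σ → I.measure (pullBack _ s) ≤ I.measure σ := by
  have hle : ∀ σ, I.IsSol σ → (reduceInst I).measure s ≤ I.measure σ := fun σ hσ =>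
    (hs _).trans (measure_append_of_isSol hσ).le
  obtain ⟨σ₀, hσ₀⟩ := hsat
  have hzero := gadgets_eq_zero_of_measure_lt
    ((hle σ₀ hσ₀).trans_lt (measure_lt_heavyWeight I σ₀))
  have hw : heavyWeight I ≠ 0 := pow_ne_zero _ two_ne_zero
  set g : D → D := fun e => s (Fin.castAdd _ (idx e)) with hg
  have hgendo : ∀ h ∈ Γ, IsEndo h g := isEndo_of_gadget (r := none) hw fun t ht =>
    hzero t (List.mem_append_right _ ht)
  have hginj := hcore g hgendo
  have hgsurj := Finite.injective_iff_surjective.1 hginj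
  constructor
  · refine isSol_iff.2 fun c hc => ?_
    have hinj := hcore _ <| isEndo_of_gadget (r := some (constOf c.rel, constVar c)) hw
      fun t ht => hzero t (List.mem_append_left _ (List.mem_flatMap.2 ⟨c, hc, ht⟩))
    obtain ⟨e, he⟩ := hgsurj (s (Fin.natAdd _ (constVar c)))
    have hed : e = constOf c.rel := by
      by_contra hne
      -- If `e` were not the constant, the modified map would send both `e` and the constant to the
      -- value of the constrained variable.
      refine hne (hinj ?_)
      simpa [elemVar, hne] using he
    rw [pullBack, ← he, invOrSelf_apply hginj, hed]
  · intro σ hσ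
    refine le_trans ?_ (hle σ hσ)
    rw [measure_reduceInst]
    refine le_trans ?_ le_self_add
    refine measure_le_of_imp fun t _ h => ?_
    -- The pulled-back assignment is the inverse of `g` after `s`, so it keeps every zero of `s`.
    exact isEndo_invOrSelf (hgendo t.fn.1 t.fn.2) hginj _ h

end CoreReduction

/-! ## Reading instances -/

namespace CoreReduction

variable {D : Type} {Γ : Set (CostFn D)}

instance {Δ : Set (FinRel D)} [Finite Γ] [Finite Δ] : Finite (CSPSym Γ Δ) := by
  let f : CSPSym Γ Δ → Γ ⊕ Δ ⊕ Bool ⊕ Bool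
    | .fn f => .inl f
    | .rel R => .inr (.inl R)
    | .bit b => .inr (.inr (.inl b))
    | .tick => .inr (.inr (.inr true))
    | .sep => .inr (.inr (.inr false))
  refine Finite.of_injective f ?_
  rintro (_ | _ | _ | _ | _) (_ | _ | _ | _ | _) h <;> simp_all [f]

instance [Finite D] : Finite (constRels D) := (Set.finite_range _).to_subtype

/-- The part of an instance that is being read. -/
inductive Phase
  /-- the variables of the instance, or the weight of a term -/
  | head
  /-- the denominator or the variables of a term -/
  | args
  /-- a constraint application -/
  | constr

instance : Finite Phase := by
  let f : Phase → Option Bool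
    | .head => none
    | .args => some true
    | .constr => some false
  refine Finite.of_injective f ?_
  rintro (_ | _ | _) (_ | _ | _) h <;> simp_all [f]

variable (Γ) in
/-- The tokens into which an instance is split, apart from the strokes of the unary notation of the
variable of a constraint application. -/
inductive Token
  /-- a letter to be copied -/
  | lit (a : CSPSym Γ ∅)
  /-- the separator before a variable of a term -/
  | argSep
  /-- the application of a constant relation, or the end of the instance -/
  | const (d : Option D)

instance [Finite D] [Finite Γ] : Finite (Token Γ) := by
  let f : Token Γ → Option (CSPSym Γ ∅ ⊕ Option D)
    | .lit a => some (.inl a)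
    | .argSep => none
    | .const d => some (.inr d)
  refine Finite.of_injective f ?_
  rintro (_ | _ | _) (_ | _ | _) h <;> simp_all [f]

/-- Read one letter of an instance; `none` is a stroke of the unary notation of the variable of a
constraint application. -/
noncomputable def readSym : Phase → CSPSym Γ (constRels D) → Phase × List (Option (Token Γ))
  | _, .fn f => (.head, [some (.lit (.fn f))])
  | _, .rel R => (.constr, [some (.const (some (constOf R)))])
  | q, .bit b => (q, [some (.lit (.bit b))])
  | .constr, .tick => (.constr, [none])
  | q, .tick => (q, [some (.lit .tick)])
  | .head, .sep => (.args, [some (.lit .sep)])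
  | .args, .sep => (.args, [some .argSep])
  | .constr, .sep => (.constr, [])

theorem length_readSym (q : Phase) (a : CSPSym Γ (constRels D)) :
    (readSym q a).2.length ≤ 1 := by
  cases q <;> cases a <;> simp [readSym]

/-- The tokens of a word. -/
noncomputable def tokenize : Phase → List (CSPSym Γ (constRels D)) → List (Option (Token Γ))
  | _, [] => []
  | q, a :: w => (readSym q a).2 ++ tokenize (readSym q a).1 w

theorem length_tokenize (q : Phase) (w : List (CSPSym Γ (constRels D))) :
    (tokenize q w).length ≤ w.length := by
  induction w generalizing q with
  | nil => simp [tokenize]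
  | cons a w ih =>
    have := length_readSym q a
    have := ih (readSym q a).1
    simp only [tokenize, List.length_append, List.length_cons]
    omega

/-- The token of a letter to be copied. -/
def litTok (a : CSPSym Γ ∅) : Option (Token Γ) := some (.lit a)

/-- The tokens of a list of variables. -/
def argTokens {n : ℕ} (l : List (Fin n)) : List (Option (Token Γ)) :=
  l.flatMap fun v => some .argSep :: List.replicate v.val (litTok .tick)

/-- The tokens of a term. -/
def termTokens {n : ℕ} (t : CSPTerm Γ n) : List (Option (Token Γ)) :=
  litTok (.fn t.fn) :: ((CSPInst.encNat t.weight.num).map litTok ++ litTok .sep ::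
    ((CSPInst.encNat t.weight.den).map litTok ++ argTokens (List.ofFn t.args)))

/-- The tokens of a constraint application. -/
noncomputable def constTokens {n : ℕ} (c : CSPConstraint (constRels D) n) :
    List (Option (Token Γ)) :=
  some (.const (some (constOf c.rel))) :: List.replicate (constVar c).val none

theorem tokenize_ticks {q : Phase} (hq : q ≠ .constr) (n : ℕ)
    (w : List (CSPSym Γ (constRels D))) :
    tokenize q (List.replicate n .tick ++ w) =
      List.replicate n (litTok .tick) ++ tokenize q w := by
  induction n with
  | zero => simp
  | succ n ih =>
    have : readSym q (.tick : CSPSym Γ (constRels D)) = (q, [litTok .tick]) := by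
      cases q <;> simp_all [readSym, litTok]
    simp [List.replicate_succ, tokenize, this, ih]

theorem tokenize_encNat (q : Phase) (m : ℕ) (w : List (CSPSym Γ (constRels D))) :
    tokenize q (CSPInst.encNat m ++ w) = (CSPInst.encNat m).map litTok ++ tokenize q w := by
  unfold CSPInst.encNat
  induction Nat.bits m with
  | nil => simp
  | cons b l ih =>
    have : readSym q (.bit b : CSPSym Γ (constRels D)) = (q, [litTok (.bit b)]) := by
      cases q <;> simp [readSym, litTok]
    simp [tokenize, this, ih]

theorem tokenize_encArgs {n : ℕ} (l : List (Fin n)) (w : List (CSPSym Γ (constRels D))) :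
    tokenize .args (CSPInst.encArgs l ++ w) = argTokens l ++ tokenize .args w := by
  induction l with
  | nil => simp [CSPInst.encArgs, argTokens]
  | cons v l ih =>
    simp only [CSPInst.encArgs, argTokens] at ih ⊢
    simp [tokenize, readSym, tokenize_ticks, ih]

theorem tokenize_encTerm (q : Phase) {n : ℕ} (t : CSPTerm Γ n)
    (w : List (CSPSym Γ (constRels D))) :
    tokenize q (CSPInst.encTerm t ++ w) = termTokens t ++ tokenize .args w := by
  simp [CSPInst.encTerm, termTokens, tokenize, tokenize_encNat, readSym, tokenize_encArgs,
    litTok]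

theorem tokenize_encConstraints (q : Phase) {n : ℕ} (l : List (CSPConstraint (constRels D) n)) :
    tokenize q (l.flatMap CSPInst.encConstraint : List (CSPSym Γ (constRels D))) =
      l.flatMap constTokens := by
  have hticks : ∀ (m : ℕ) (w : List (CSPSym Γ (constRels D))),
      tokenize .constr (List.replicate m .tick ++ w) =
        List.replicate m none ++ tokenize .constr w := by
    intro m w
    induction m with
    | zero => simp
    | succ m ih => simp [List.replicate_succ, tokenize, readSym, ih]
  induction l generalizing q with
  | nil => rfl
  | cons c l ih =>
    simp [encConstraint_eq, tokenize, readSym, hticks, ih, constTokens]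

theorem tokenize_enc (I : CSPInst Γ (constRels D)) :
    tokenize .head I.enc = List.replicate I.numVars (litTok .tick) ++
      (I.terms.flatMap termTokens ++ I.constraints.flatMap constTokens) := by
  have key : ∀ (l : List (CSPTerm Γ I.numVars)) (q : Phase), tokenize q
      (l.flatMap CSPInst.encTerm ++ I.constraints.flatMap CSPInst.encConstraint) =
        l.flatMap termTokens ++ I.constraints.flatMap constTokens := by
    intro l
    induction l with
    | nil => exact fun q => tokenize_encConstraints q _
    | cons t l ih =>
      intro q
      rw [List.flatMap_cons, List.append_assoc, tokenize_encTerm, ih]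
      simp
  rw [CSPInst.enc, tokenize_ticks (by simp), key]

/-! ## Writing the reduced instance -/

/-- Pieces from which the reduced instance is assembled. -/
inductive Piece (A : Type)
  /-- a letter -/
  | lit (a : A)
  /-- the unary notation of the variable of a constraint application -/
  | var
  /-- the zeros in the binary notation of the weight of the gadgets -/
  | zeros

/-- The word denoted by a piece, for the variable `x` and the weight `2 ^ L`. -/
def expand (x L : ℕ) : Piece (CSPSym Γ ∅) → List (CSPSym Γ ∅)
  | .lit a => [a]
  | .var => List.replicate x .tick
  | .zeros => List.replicate L (.bit false)

theorem flatMap_expand_lit (x L : ℕ) (l : List (CSPSym Γ ∅)) :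
    (l.map Piece.lit).flatMap (expand x L) = l := by
  simp [List.flatMap_map, expand]

theorem flatMap_expand_ticks (x L n : ℕ) :
    (List.replicate n (.lit .tick : Piece (CSPSym Γ ∅))).flatMap (expand x L) =
      List.replicate n .tick := by
  rw [← List.map_replicate, flatMap_expand_lit]

theorem bits_two_pow (L : ℕ) : (2 ^ L).bits = List.replicate L false ++ [true] := by
  induction L with
  | zero => simp
  | succ L ih =>
    rw [pow_succ', Nat.bit0_bits _ (by positivity), ih, List.replicate_succ]
    rfl

theorem flatMap_ofFn {A B : Type} {n : ℕ} (f : Fin n → A) (g : A → List B) :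
    (List.ofFn f).flatMap g = (List.ofFn fun i => g (f i)).flatten := by
  rw [List.flatMap_def, List.map_ofFn]
  rfl

variable [Finite D]

/-- The unary notation of the variable representing `e`. -/
noncomputable def elemWord (d : Option D) (e : D) : List (Piece (CSPSym Γ ∅)) :=
  open scoped Classical in
  if d = some e then List.replicate (Nat.card D) (.lit .tick) ++ [.var]
  else List.replicate (idx e).val (.lit .tick)

/-- The notation of a gadget. -/
noncomputable def gadgetWord [Finite Γ] (d : Option D) : List (Piece (CSPSym Γ ∅)) :=
  (zeroTuples Γ).flatMap fun p =>
    .lit (.fn p.1) :: .zeros :: .lit (.bit true) :: .lit .sep :: .lit (.bit true) ::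
      (List.ofFn p.2).flatMap fun e => .lit .sep :: elemWord d e

/-- The pieces written for a token. -/
noncomputable def tokenWord [Finite Γ] : Token Γ → List (Piece (CSPSym Γ ∅))
  | .lit a => [.lit a]
  | .argSep => .lit .sep :: List.replicate (Nat.card D) (.lit .tick)
  | .const d => gadgetWord d

/-- The word written for a list of tokens in reversed order in front of the word `o`, where `x`
strokes have been read already. -/
noncomputable def emit [Finite Γ] (L : ℕ) :
    List (Option (Token Γ)) → ℕ → List (CSPSym Γ ∅) → List (CSPSym Γ ∅)
  | [], _, o => o
  | none :: r, x, o => emit L r (x + 1) o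
  | some a :: r, x, o => emit L r 0 ((tokenWord a).flatMap (expand x L) ++ o)

/-- The tokens `u` are written as the word `y`. -/
def Emits [Finite Γ] (L : ℕ) (u : List (Option (Token Γ))) (y : List (CSPSym Γ ∅)) : Prop :=
  ∀ r o, emit L (u.reverse ++ r) 0 o = emit L r 0 (y ++ o)

theorem Emits.nil [Finite Γ] {L : ℕ} : Emits L ([] : List (Option (Token Γ))) [] :=
  fun _ _ => rfl

theorem Emits.append [Finite Γ] {L : ℕ} {u u' : List (Option (Token Γ))}
    {y y' : List (CSPSym Γ ∅)} (h : Emits L u y) (h' : Emits L u' y') :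
    Emits L (u ++ u') (y ++ y') := by
  intro r o
  rw [List.reverse_append, List.append_assoc, h', h, List.append_assoc]

theorem Emits.flatMap [Finite Γ] {L : ℕ} {X : Type} {u : X → List (Option (Token Γ))}
    {y : X → List (CSPSym Γ ∅)} (h : ∀ a, Emits L (u a) (y a)) (l : List X) :
    Emits L (l.flatMap u) (l.flatMap y) := by
  induction l with
  | nil => exact .nil
  | cons a l ih => exact (h a).append ih

theorem emits_lit [Finite Γ] (L : ℕ) (a : CSPSym Γ ∅) : Emits L [litTok a] [a] := by
  intro r o
  simp [litTok, emit, tokenWord, expand]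

theorem emits_map_litTok [Finite Γ] (L : ℕ) (l : List (CSPSym Γ ∅)) :
    Emits L (l.map litTok) l := by
  have := Emits.flatMap (emits_lit L) l
  simpa [List.map_eq_flatMap] using this

theorem emits_argTokens [Finite Γ] (L : ℕ) {n : ℕ} (l : List (Fin n)) :
    Emits (Γ := Γ) L (argTokens l) (CSPInst.encArgs (l.map (Fin.natAdd (Nat.card D)))) := by
  rw [CSPInst.encArgs, List.flatMap_map]
  refine Emits.flatMap (fun v => ?_) l
  have h₁ : Emits (Γ := Γ) L [some .argSep] (.sep :: List.replicate (Nat.card D) .tick) := by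
    intro r o
    simp [emit, tokenWord, expand, flatMap_expand_ticks]
  have h₂ := emits_map_litTok L (List.replicate v.val (.tick : CSPSym Γ ∅))
  rw [List.map_replicate] at h₂
  have := h₁.append h₂
  simpa [List.replicate_append_replicate] using this

theorem emits_termTokens [Finite Γ] (L : ℕ) {n : ℕ} (t : CSPTerm Γ n) :
    Emits L (termTokens t) (CSPInst.encTerm (shiftTerm (Nat.card D) t)) := by
  have h := emits_argTokens (Γ := Γ) L (List.ofFn t.args)
  rw [List.map_ofFn] at h
  exact (emits_lit L _).append ((emits_map_litTok L _).append ((emits_lit L _).append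
    ((emits_map_litTok L _).append h)))

/-- The counter `x` matters only if a constraint is being replaced. For `r = none` no `.var` piece
occurs and `x` is arbitrary. -/
theorem expand_gadgetWord [Finite Γ] (L : ℕ) {n : ℕ} (r : Option (D × Fin n)) (x : ℕ)
    (hx : ∀ p ∈ r, x = p.2.val) :
    (gadgetWord (Γ := Γ) (r.map Prod.fst)).flatMap (expand x L) =
      (gadget (Γ := Γ) n (2 ^ L) r).flatMap CSPInst.encTerm := by
  have helem : ∀ e : D, (elemWord (Γ := Γ) (r.map Prod.fst) e).flatMap (expand x L) =
      List.replicate (elemVar n r e).val .tick := by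
    intro e
    rcases r with _ | ⟨d, v⟩
    · simp [elemWord, elemVar, flatMap_expand_ticks]
    · have := hx (d, v) rfl
      by_cases he : e = d
      · simp [elemWord, elemVar, he, List.flatMap_append, flatMap_expand_ticks, expand, this,
          List.replicate_append_replicate]
      · have he' : ¬ d = e := fun h => he h.symm
        simp [elemWord, elemVar, he, he', flatMap_expand_ticks]
  -- In lowest terms the weight is 2^L over 1: the pieces `.zeros` and a one bit for the numerator,
  -- a separator, and a single one bit.
  have hnum : ((2 : ℚ≥0) ^ L).num = 2 ^ L := by
    have : ((2 : ℚ≥0) ^ L) = ((2 ^ L : ℕ) : ℚ≥0) := by simp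
    rw [this, NNRat.num_natCast]
  have hden : ((2 : ℚ≥0) ^ L).den = 1 := by
    have : ((2 : ℚ≥0) ^ L) = ((2 ^ L : ℕ) : ℚ≥0) := by simp
    rw [this, NNRat.den_natCast]
  rw [gadgetWord, gadget, List.flatMap_assoc, List.flatMap_map]
  congr 1
  funext p
  have hargs : ((List.ofFn p.2).flatMap fun e =>
      .lit .sep :: elemWord (Γ := Γ) (r.map Prod.fst) e).flatMap (expand x L) =
        CSPInst.encArgs (List.ofFn fun i => elemVar n r (p.2 i)) := by
    rw [List.flatMap_assoc, CSPInst.encArgs, flatMap_ofFn, flatMap_ofFn]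
    simp [expand, helem]
  simp [CSPInst.encTerm, CSPInst.encNat, hnum, hden, bits_two_pow, expand, hargs]

/-- In reversed order the strokes of the variable precede its relation, so the counter holds the
index of the variable when the constant is met. -/
theorem emits_constTokens [Finite Γ] (L : ℕ) {n : ℕ} (c : CSPConstraint (constRels D) n) :
    Emits L (constTokens c) ((gadget (Γ := Γ) n (2 ^ L)
      (some (constOf c.rel, constVar c))).flatMap CSPInst.encTerm) := by
  have hnone : ∀ (m x : ℕ) (r : List (Option (Token Γ))) o,
      emit L (List.replicate m none ++ r) x o = emit L r (x + m) o := by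
    intro m
    induction m with
    | zero => simp
    | succ m ih => intro x r o; simp [List.replicate_succ, emit, ih]; congr 1; omega
  intro r o
  rw [← expand_gadgetWord L _ (constVar c).val (by rintro p ⟨⟩; rfl)]
  simp [constTokens, hnone, emit, tokenWord]

/-- The reduced instance is written token by token. -/
theorem enc_reduceInst [Finite Γ] (I : CSPInst Γ (constRels D)) :
    (reduceInst I).enc = List.replicate (Nat.card D) .tick ++
      emit I.enc.length (some (.const none) :: (tokenize .head I.enc).reverse) 0 [] := by
  -- The unmodified gadget comes last in the output, hence its token is read first.
  have h₁ : Emits I.enc.length [some (.const none)]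
      ((gadget (Γ := Γ) I.numVars (2 ^ I.enc.length) none).flatMap CSPInst.encTerm) := by
    intro r o
    rw [← expand_gadgetWord _ _ 0 (by simp)]
    simp [emit, tokenWord]
  have h₂ := emits_map_litTok I.enc.length (List.replicate I.numVars (.tick : CSPSym Γ ∅))
  rw [List.map_replicate] at h₂
  have h := (h₂.append ((Emits.flatMap (emits_termTokens I.enc.length) I.terms).append
    (Emits.flatMap (emits_constTokens I.enc.length) I.constraints))).append h₁ [] []
  rw [← tokenize_enc, List.reverse_append, List.append_nil, List.reverse_singleton,
    List.singleton_append] at h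
  rw [h]
  simp [CSPInst.enc, reduceInst, gadgets, emit, heavyWeight, List.flatMap_append,
    List.flatMap_map, List.flatMap_assoc, ← List.replicate_append_replicate]

end CoreReduction

/-! ## The program that reduces instances -/

namespace CoreReduction

open StackProg

variable {D : Type} {Γ : Set (CostFn D)}

/-- The stacks of the program that reduces instances. -/
inductive RStack
  | inp | toks | count | tmp | unary | out
  deriving DecidableEq

instance : Fintype RStack where
  elems := {.inp, .toks, .count, .tmp, .unary, .out}
  complete k := by cases k <;> simp

variable (Γ) in
/-- The alphabets of the stacks. -/
abbrev RAlph : RStack → Type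
  | .inp => CSPSym Γ (constRels D)
  | .toks => Option (Token Γ)
  | .count => Unit
  | .tmp => Unit
  | .unary => Unit
  | .out => CSPSym Γ ∅

instance [Finite D] [Finite Γ] (k : RStack) : Finite (RAlph Γ k) := by
  cases k <;> (simp only [RAlph]; infer_instance)

/-- The contents of the stacks. -/
def rStacks (w : List (CSPSym Γ (constRels D))) (u : List (Option (Token Γ))) (L x : ℕ)
    (o : List (CSPSym Γ ∅)) : ∀ k, List (RAlph Γ k)
  | .inp => w
  | .toks => u
  | .count => List.replicate L ()
  | .tmp => []
  | .unary => List.replicate x ()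
  | .out => o

section Stacks

variable (w w' : List (CSPSym Γ (constRels D))) (u u' : List (Option (Token Γ))) (L x : ℕ)
  (o o' : List (CSPSym Γ ∅))

theorem update_inp : update (rStacks w u L x o) .inp w' = rStacks w' u L x o := by
  funext k; cases k <;> rfl

theorem update_toks : update (rStacks w u L x o) .toks u' = rStacks w u' L x o := by
  funext k; cases k <;> rfl

theorem update_out : update (rStacks w u L x o) .out o' = rStacks w u L x o' := by
  funext k; cases k <;> rfl

theorem update_count_cons : update (rStacks w u L x o) .count
    (() :: rStacks w u L x o .count) = rStacks w u (L + 1) x o := by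
  funext k; cases k <;> rfl

theorem update_count_nil : update (rStacks w u L x o) .count [] = rStacks w u 0 x o := by
  funext k; cases k <;> rfl

theorem update_unary_cons : update (rStacks w u L x o) .unary
    (() :: rStacks w u L x o .unary) = rStacks w u L (x + 1) o := by
  funext k; cases k <;> rfl

theorem update_unary_nil : update (rStacks w u L x o) .unary [] = rStacks w u L 0 o := by
  funext k; cases k <;> rfl

end Stacks

/-- Split the input into tokens and count its letters. -/
noncomputable def readInput : StackProg (RAlph Γ) Phase :=
  forEach .inp fun a => seq (push .count ()) (case fun q =>
    seq (pushWord .toks (readSym q a).2.reverse) (load fun _ => (readSym q a).1))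

theorem run_readInput (w : List (CSPSym Γ (constRels D))) (q : Phase)
    (u : List (Option (Token Γ))) (L : ℕ) :
    ∃ q', Run readInput q (rStacks w u L 0 []) (6 * w.length + 1) q'
      (rStacks [] ((tokenize q w).reverse ++ u) (L + w.length) 0 []) := by
  induction w generalizing q u L with
  | nil => exact ⟨q, (Run.forEach_nil rfl).congr (by simp) rfl rfl⟩
  | cons a w ih =>
    obtain ⟨q', h⟩ := ih (readSym q a).1 ((readSym q a).2.reverse ++ u) (L + 1)
    refine ⟨q', ?_⟩
    have hbody : Run (seq (push .count ()) (case fun q =>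
        seq (pushWord .toks (readSym q a).2.reverse) (load fun _ => (readSym q a).1)))
        q (rStacks w u L 0 []) 5 (readSym q a).1
        (rStacks w ((readSym q a).2.reverse ++ u) (L + 1) 0 []) := by
      refine (Run.push.seq (Run.case ((Run.pushWord _ _ _ _).seq Run.load))).congr ?_ rfl ?_
      · have := length_readSym q a
        simp only [List.length_reverse]
        omega
      · rw [update_count_cons, update_toks]
        rfl
    refine (Run.forEach_cons (k := RStack.inp) (a := a) (l := w) rfl (by rw [update_inp]; exact hbody) h).congr
      ?_ rfl ?_
    · simp only [List.length_cons]
      omega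
    · simp [tokenize, add_assoc, add_comm 1]

/-- Write a piece. -/
def writePiece : Piece (CSPSym Γ ∅) → StackProg (RAlph Γ) Phase
  | .lit a => push .out a
  | .var => pushCopies .unary .tmp .out id id CSPSym.tick
  | .zeros => pushCopies .count .tmp .out id id (CSPSym.bit false)

theorem run_writePiece (p : Piece (CSPSym Γ ∅)) (q : Phase) (u : List (Option (Token Γ)))
    {L x B : ℕ} (hL : L ≤ B) (hx : x ≤ B) (o : List (CSPSym Γ ∅)) :
    Run (writePiece p) q (rStacks [] u L x o) (5 * B + 2) q
      (rStacks [] u L x (expand x L p ++ o)) := by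
  cases p with
  | lit a =>
    refine Run.push.congr (by omega) rfl ?_
    rw [update_out]
    rfl
  | var =>
    refine (Run.pushCopies (k := RStack.unary) (by simp) (by simp) (by simp) (fun _ => rfl)
      _ _ _ rfl).congr ?_ rfl ?_
    · simp only [rStacks, List.length_replicate]
      omega
    · rw [update_out]
      simp [rStacks, expand]
  | zeros =>
    refine (Run.pushCopies (k := RStack.count) (by simp) (by simp) (by simp) (fun _ => rfl)
      _ _ _ rfl).congr ?_ rfl ?_
    · simp only [rStacks, List.length_replicate]
      omega
    · rw [update_out]
      simp [rStacks, expand]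

/-- Write a list of pieces. -/
def writePieces : List (Piece (CSPSym Γ ∅)) → StackProg (RAlph Γ) Phase
  | [] => skip
  | p :: l => seq (writePieces l) (writePiece p)

theorem run_writePieces (l : List (Piece (CSPSym Γ ∅))) (q : Phase)
    (u : List (Option (Token Γ))) {L x B : ℕ} (hL : L ≤ B) (hx : x ≤ B) (o : List (CSPSym Γ ∅)) :
    Run (writePieces l) q (rStacks [] u L x o) (l.length * (5 * B + 2) + 1) q
      (rStacks [] u L x (l.flatMap (expand x L) ++ o)) := by
  induction l with
  | nil => exact Run.skip.congr (by simp) rfl rfl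
  | cons p l ih =>
    refine (ih.seq (run_writePiece p q u hL hx _)).congr ?_ rfl ?_
    · simp only [List.length_cons, add_mul]
      omega
    · simp

variable [Finite D]

/-- Write the output token by token. -/
noncomputable def writeTokens [Finite Γ] : StackProg (RAlph Γ) Phase :=
  forEach .toks fun a : Option (Token Γ) =>
    a.elim (push .unary ()) fun a => seq (writePieces (tokenWord a)) (clear .unary)

/-- Each token raises the unary counter by at most one, so the counter plus the number of remaining
tokens stays below `B`. The final counter need not be known: it is cleared later. -/
theorem run_writeTokens [Finite Γ] {C : ℕ} (hC : ∀ a : Token Γ, (tokenWord a).length ≤ C)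
    {L B : ℕ} (hL : L ≤ B) (q : Phase) (u : List (Option (Token Γ))) (x : ℕ)
    (hx : x + u.length ≤ B) (o : List (CSPSym Γ ∅)) :
    ∃ x' ≤ B, Run writeTokens q (rStacks [] u L x o)
      (u.length * (C * (5 * B + 2) + 2 * B + 4) + 1) q (rStacks [] [] L x' (emit L u x o)) := by
  induction u generalizing x o with
  | nil => exact ⟨x, hx, (Run.forEach_nil rfl).congr (by simp) rfl rfl⟩
  | cons a u ih =>
    rw [List.length_cons] at hx
    cases a with
    | none =>
      obtain ⟨x', hx', h⟩ := ih (x + 1) (by omega) o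
      refine ⟨x', hx', (Run.forEach_cons (a := none) (l := u) (t := 1) rfl ?_ h).congr ?_ rfl rfl⟩
      · rw [update_toks]
        exact Run.push.congr le_rfl rfl (update_unary_cons _ _ _ _ _)
      · simp only [List.length_cons, add_mul]
        omega
    | some a =>
      obtain ⟨x', hx', h⟩ := ih 0 (by omega) ((tokenWord a).flatMap (expand x L) ++ o)
      refine ⟨x', hx', (Run.forEach_cons (a := some a) (l := u)
        (t := C * (5 * B + 2) + 1 + (2 * B + 1)) rfl ?_ h).congr ?_ rfl rfl⟩
      · rw [update_toks]
        refine (((run_writePieces (tokenWord a) q u hL (by omega) o).mono ?_).seq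
          ((Run.clear _ _ _).mono ?_)).congr le_rfl rfl (update_unary_nil _ _ _ _ _)
        · gcongr
          exact hC a
        · simp only [rStacks, List.length_replicate]
          omega
      · simp only [List.length_cons, add_mul]
        omega

/-- The program that reduces instances. -/
noncomputable def reduceProg [Finite Γ] : StackProg (RAlph Γ) Phase :=
  seq readInput (seq (push .toks (some (Token.const none))) (seq (load fun _ => .head)
    (seq writeTokens (seq (clear .count) (seq (clear .unary)
      (pushWord .out (List.replicate (Nat.card D) CSPSym.tick)))))))

theorem polyTimeComputable_reduceInst [Finite Γ] :
    PolyTimeComputable (CSPInst.enc : CSPInst Γ (constRels D) → _) CSPInst.enc reduceInst := by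
  -- There are finitely many tokens because D and Γ are fixed, so the number of pieces per token is
  -- bounded by a constant.
  obtain ⟨C, hC⟩ := (Set.finite_range fun a : Token Γ => (tokenWord a).length).bddAbove
  replace hC : ∀ a : Token Γ, (tokenWord a).length ≤ C := fun a => hC ⟨a, rfl⟩
  let X : Polynomial ℕ := Polynomial.X
  refine polyTimeComputable (reduceProg (Γ := Γ)) .inp .out Phase.head _ _ _
    (6 * X + 1 + (1 + (1 + ((X + 1) * ((C : Polynomial ℕ) * (5 * (X + 1) + 2) + 2 * (X + 1) + 4)
      + 1 + (2 * X + 1 + (2 * (X + 1) + 1 + ((Nat.card D : Polynomial ℕ) + 1))))))) fun I => ?_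
  have hinit : update (β := fun k => List (RAlph Γ k)) (fun _ => []) .inp I.enc = rStacks I.enc [] 0 0 [] := by
    funext k; cases k <;> rfl
  have hfinal : update (β := fun k => List (RAlph Γ k)) (fun _ => []) .out (reduceInst I).enc =
      rStacks [] [] 0 0 (reduceInst I).enc := by
    funext k; cases k <;> rfl
  rw [hinit, hfinal, enc_reduceInst]
  obtain ⟨q', h₁⟩ := run_readInput I.enc .head [] 0
  rw [List.append_nil, Nat.zero_add] at h₁
  have hlen := length_tokenize .head I.enc
  -- The bound is the input length plus one, the extra token being the one for the unmodified
  -- gadget.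
  obtain ⟨x', hx', h₂⟩ := run_writeTokens hC (Nat.le_add_right I.enc.length 1) .head
    (some (.const none) :: (tokenize .head I.enc).reverse) 0
    (by simp only [List.length_cons, List.length_reverse]; omega) []
  set L := I.enc.length
  set u := (tokenize .head I.enc).reverse with hu
  set o := emit L (some (.const none) :: u) 0 []
  have hpush : Run (push .toks (some (Token.const none))) q' (rStacks [] u L 0 []) 1 q'
      (rStacks [] (some (.const none) :: u) L 0 []) :=
    Run.push.congr le_rfl rfl (update_toks _ _ _ _ _ _)
  have hcount : Run (clear .count) Phase.head (rStacks [] [] L x' o) (2 * L + 1) Phase.head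
      (rStacks [] [] 0 x' o) :=
    (Run.clear _ _ _).congr (by simp [rStacks]) rfl (update_count_nil _ _ _ _ _)
  have hunary : Run (clear .unary) Phase.head (rStacks [] [] 0 x' o) (2 * (L + 1) + 1)
      Phase.head (rStacks [] [] 0 0 o) :=
    (Run.clear _ _ _).congr (by simpa [rStacks] using hx') rfl (update_unary_nil _ _ _ _ _)
  have hticks : Run (pushWord (Γ := RAlph Γ) .out (List.replicate (Nat.card D) .tick)) Phase.head
      (rStacks [] [] 0 0 o) (Nat.card D + 1) Phase.head
      (rStacks [] [] 0 0 (List.replicate (Nat.card D) .tick ++ o)) :=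
    (Run.pushWord _ _ _ _).congr (by simp) rfl (update_out _ _ _ _ _ _)
  refine (h₁.seq (hpush.seq (Run.load.seq (h₂.seq (hcount.seq (hunary.seq hticks)))))).congr
    ?_ rfl rfl
  have hul : (some (Token.const none) :: u).length ≤ L + 1 := by
    simpa [hu] using hlen
  simp only [X, Polynomial.eval_add, Polynomial.eval_mul, Polynomial.eval_natCast,
    Polynomial.eval_X, Polynomial.eval_one, Polynomial.eval_ofNat, Nat.cast_id]
  gcongr

end CoreReduction

/-! ## The program that recovers solutions -/

namespace CoreReduction

open StackProg

variable {D : Type} {Γ : Set (CostFn D)}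

/-- The stacks of the program that recovers solutions. -/
inductive SStack
  | inp | toks | vals | tmp | out
  deriving DecidableEq

instance : Fintype SStack where
  elems := {.inp, .toks, .vals, .tmp, .out}
  complete k := by cases k <;> simp

variable (Γ) in
/-- The alphabets of the stacks. -/
abbrev SAlph : SStack → Type
  | .inp => CSPSym Γ (constRels D) ⊕ D
  | .toks => Option (Token Γ)
  | .vals => D
  | .tmp => D
  | .out => Option D

instance [Finite D] [Finite Γ] (k : SStack) : Finite (SAlph Γ k) := by
  cases k <;> (simp only [SAlph]; infer_instance)

/-- The contents of the stacks. -/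
def sStacks (w : List (CSPSym Γ (constRels D) ⊕ D)) (u : List (Option (Token Γ)))
    (l l' : List D) (o : List (Option D)) : ∀ k, List (SAlph Γ k)
  | .inp => w
  | .toks => u
  | .vals => l
  | .tmp => l'
  | .out => o

section Stacks

variable (w w' : List (CSPSym Γ (constRels D) ⊕ D)) (u u' : List (Option (Token Γ)))
  (l l' m : List D) (o o' : List (Option D))

theorem supdate_inp : update (sStacks w u l l' o) .inp w' = sStacks w' u l l' o := by
  funext k; cases k <;> rfl

theorem supdate_toks : update (sStacks w u l l' o) .toks u' = sStacks w u' l l' o := by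
  funext k; cases k <;> rfl

theorem supdate_vals : update (sStacks w u l l' o) .vals m = sStacks w u m l' o := by
  funext k; cases k <;> rfl

theorem supdate_tmp : update (sStacks w u l l' o) .tmp m = sStacks w u l m o := by
  funext k; cases k <;> rfl

theorem supdate_out : update (sStacks w u l l' o) .out o' = sStacks w u l l' o' := by
  funext k; cases k <;> rfl

end Stacks

variable (D) in
/-- The register: the part of the instance that is being read, the values of the variables that
represent the domain elements, and whether the constraint applications are satisfied. -/
abbrev SReg : Type := Phase × (D → D) × Bool

section Moves

variable (v : SReg D) (u : List (Option (Token Γ))) (l l' : List D)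

theorem run_move_tmp_vals : Run (move .tmp .vals id) v (sStacks [] u l l' [])
    (2 * l'.length + 1) v (sStacks [] u (l'.reverse ++ l) [] []) := by
  refine (Run.move (Γ := SAlph Γ) (k := SStack.tmp) (k' := SStack.vals) (by simp) id v _).congr le_rfl rfl ?_
  rw [supdate_tmp, supdate_vals]
  simp [sStacks]

theorem run_move_vals_tmp (f : D → D) : Run (move .vals .tmp f) v (sStacks [] u l l' [])
    (2 * l.length + 1) v (sStacks [] u [] ((l.map f).reverse ++ l') []) := by
  refine (Run.move (Γ := SAlph Γ) (k := SStack.vals) (k' := SStack.tmp) (by simp) f v _).congr le_rfl rfl ?_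
  rw [supdate_vals, supdate_tmp]
  simp [sStacks]

theorem run_move_tmp_out : Run (move .tmp .out some) v (sStacks [] u l l' [])
    (2 * l'.length + 1) v (sStacks [] u l [] (l'.map some).reverse) := by
  refine (Run.move (Γ := SAlph Γ) (k := SStack.tmp) (k' := SStack.out) (by simp) some v _).congr le_rfl rfl ?_
  rw [supdate_tmp, supdate_out]
  simp [sStacks]

theorem run_clear_vals : Run (clear .vals) v (sStacks [] u l l' [])
    (2 * l.length + 1) v (sStacks [] u [] l' []) :=
  (Run.clear _ v _).congr le_rfl rfl (supdate_vals _ _ _ _ _ _)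

end Moves

/-- Split the input into the tokens of the instance and the values of its variables. -/
noncomputable def readPair : StackProg (SAlph Γ) (SReg D) :=
  forEach .inp fun a : CSPSym Γ (constRels D) ⊕ D => a.elim
    (fun a => case fun v => seq (pushWord .toks (readSym v.1 a).2.reverse)
      (load fun v' => ((readSym v.1 a).1, v'.2)))
    fun a => push .tmp a

theorem run_readPair (w : List (CSPSym Γ (constRels D))) (s : List D) (q : Phase)
    (r : (D → D) × Bool) (u : List (Option (Token Γ))) :
    ∃ q', Run readPair (q, r) (sStacks (w.map Sum.inl ++ s.map Sum.inr) u [] [] [])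
      (5 * w.length + (2 * s.length + 1)) (q', r)
      (sStacks [] ((tokenize q w).reverse ++ u) [] s.reverse []) := by
  induction w generalizing q u with
  | nil =>
    refine ⟨q, ?_⟩
    have key : ∀ (s l : List D), Run readPair (q, r) (sStacks (Γ := Γ) (s.map Sum.inr) u [] l [])
        (2 * s.length + 1) (q, r) (sStacks [] u [] (s.reverse ++ l) []) := by
      intro s
      induction s with
      | nil => exact fun l => (Run.forEach_nil rfl).congr (by simp) rfl rfl
      | cons a s ih =>
        intro l
        refine (Run.forEach_cons (k := SStack.inp) (a := .inr a) (l := s.map Sum.inr) (t := 1) rfl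
          ?_ (ih (a :: l))).congr ?_ rfl ?_
        · rw [supdate_inp]
          exact Run.push.congr le_rfl rfl (supdate_tmp _ _ _ _ _ _)
        · simp only [List.length_cons]
          omega
        · simp
    simpa [tokenize] using key s []
  | cons a w ih =>
    obtain ⟨q', h⟩ := ih (readSym q a).1 ((readSym q a).2.reverse ++ u)
    refine ⟨q', (Run.forEach_cons (k := SStack.inp) (a := .inl a)
      (l := w.map Sum.inl ++ s.map Sum.inr) (t := 4) rfl ?_ h).congr ?_ rfl ?_⟩
    · rw [supdate_inp]
      refine (Run.case ((Run.pushWord _ _ _ _).seq Run.load)).congr ?_ rfl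
        (supdate_toks _ _ _ _ _ _)
      have := length_readSym q a
      simp only [List.length_reverse]
      omega
    · simp only [List.length_cons]
      omega
    · simp [tokenize]

open scoped Classical in
/-- Load the values of the variables that represent the domain elements. -/
noncomputable def loadElems : List D → StackProg (SAlph Γ) (SReg D)
  | [] => skip
  | e :: es => seq (pop .vals fun a : Option D =>
      load fun v => (v.1, update v.2.1 e (a.getD e), v.2.2)) (loadElems es)

-- The map goes into the register, which is possible because there are only finitely many maps D →
-- D. Elements not listed in `es` keep their old value.
open scoped Classical in
theorem run_loadElems (f : D → D) (es : List D) (q : Phase) (g : D → D) (b : Bool)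
    (u : List (Option (Token Γ))) (l : List D) :
    Run (loadElems es) (q, g, b) (sStacks [] u (es.map f ++ l) [] []) (2 * es.length + 1)
      (q, fun e => if e ∈ es then f e else g e, b) (sStacks [] u l [] []) := by
  induction es generalizing g with
  | nil => exact Run.skip.congr (by simp) (by simp) rfl
  | cons e es ih =>
    have hpop : Run (pop .vals fun a : Option D =>
        load fun v => (v.1, update v.2.1 e (a.getD e), v.2.2)) (q, g, b)
        (sStacks [] u ((e :: es).map f ++ l) [] []) 2 (q, update g e (f e), b)
        (sStacks [] u (es.map f ++ l) [] []) :=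
      Run.pop (Run.load.congr le_rfl rfl (supdate_vals _ _ _ _ _ _))
    refine (hpop.seq (ih _)).congr (by simp only [List.length_cons]; omega) ?_ rfl
    congr 2
    funext e'
    by_cases h : e' = e
    · subst h
      simp
    · simp [h]

/-! ### Testing the constraint applications -/

open scoped Classical in
/-- Check the value of the variable of a constraint application. -/
noncomputable def checkToken : Token Γ → StackProg (SAlph Γ) (SReg D)
  | .const (some d) => seq (pop .vals fun a : Option D => a.elim skip fun a =>
      seq (push .vals a) (load fun v => (v.1, v.2.1, v.2.2 && decide (a = d))))
        (move .tmp .vals id)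
  | _ => skip

/-- Check the constraint applications. -/
noncomputable def checkAll : StackProg (SAlph Γ) (SReg D) :=
  forEach .toks fun a : Option (Token Γ) => a.elim
    (pop .vals fun a : Option D => a.elim skip fun a => push .tmp a) checkToken

/-- This and the next two lemmas prepend tokens to a run of the remaining loop, the form in which
`Run.forEach_cons` composes. Each stroke moves one value aside, so after as many strokes as the
index of a variable its value is on top. -/
theorem run_checkAll_strokes {v v' : SReg D} {S'} {t : ℕ} {u : List (Option (Token Γ))}
    {l₁ l₂ l' : List D}
    (h : Run checkAll v (sStacks [] u l₂ (l₁.reverse ++ l') []) t v' S') :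
    Run checkAll v (sStacks [] (List.replicate l₁.length none ++ u) (l₁ ++ l₂) l' [])
      (3 * l₁.length + t) v' S' := by
  induction l₁ generalizing l' with
  | nil => exact h.congr (by simp) rfl rfl
  | cons a l₁ ih =>
    have := ih (l' := a :: l') (by simpa using h)
    refine (Run.forEach_cons (k := SStack.toks) (a := none)
      (l := List.replicate l₁.length none ++ u) (t := 2) rfl ?_ this).congr ?_ rfl rfl
    · rw [supdate_toks]
      refine Run.pop ?_
      rw [supdate_vals]
      exact Run.push.congr le_rfl rfl (supdate_tmp _ _ _ _ _ _)
    · simp only [List.length_cons]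
      omega

open scoped Classical in
theorem run_checkAll_const {q : Phase} {g : D → D} {b : Bool} {v' : SReg D} {S'} {t : ℕ}
    {u : List (Option (Token Γ))} {d a : D} {l₁ l₂ : List D}
    (h : Run checkAll (q, g, b && decide (a = d)) (sStacks [] u (l₁ ++ a :: l₂) [] []) t v' S') :
    Run checkAll (q, g, b) (sStacks [] (some (.const (some d)) :: u) (a :: l₂) l₁.reverse [])
      (2 * l₁.length + 5 + t) v' S' := by
  have hpop : Run (pop .vals fun a : Option D => a.elim skip fun a =>
      seq (push .vals a) (load fun v => (v.1, v.2.1, v.2.2 && decide (a = d)))) (q, g, b)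
      (sStacks [] u (a :: l₂) l₁.reverse []) 3 (q, g, b && decide (a = d))
      (sStacks [] u (a :: l₂) l₁.reverse []) := by
    refine Run.pop (t := 2) ?_
    rw [supdate_vals]
    exact (Run.push.seq Run.load).congr le_rfl rfl (supdate_vals _ _ _ _ _ _)
  have hmove := run_move_tmp_vals (q, g, b && decide (a = d)) u (a :: l₂) l₁.reverse
  rw [List.reverse_reverse, List.length_reverse] at hmove
  refine (Run.forEach_cons (k := SStack.toks) (a := some (.const (some d))) (l := u)
    (t := 3 + (2 * l₁.length + 1)) rfl ?_ h).congr ?_ rfl rfl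
  · rw [supdate_toks]
    exact hpop.seq hmove
  · omega

-- A constraint on variable i costs 3i steps for its strokes and 2i + 5 for the comparison and for
-- restoring the values. The induction starts from the last constraint because the tokens are
-- stacked in reversed order.
open scoped Classical in
theorem run_checkAll_constraints {n : ℕ} (σ : Fin n → D)
    (cs : List (CSPConstraint (constRels D) n)) {q : Phase} {g : D → D} {b : Bool} {v' : SReg D}
    {S'} {t : ℕ} {u : List (Option (Token Γ))}
    (h : Run checkAll (q, g, b && decide (∀ c ∈ cs, σ (constVar c) = constOf c.rel))
      (sStacks [] u (List.ofFn σ) [] []) t v' S') :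
    Run checkAll (q, g, b)
      (sStacks [] ((cs.flatMap constTokens).reverse ++ u) (List.ofFn σ) [] [])
      (cs.length * (5 * n + 5) + t) v' S' := by
  induction cs using List.reverseRecOn generalizing b with
  | nil => exact Run.congr (by simpa using h) (by simp) rfl rfl
  | append_singleton cs c ih =>
    -- The values are split at the constrained variable: `l₁` is moved aside by the strokes and put
    -- back after the comparison.
    set l₁ := (List.ofFn σ).take (constVar c).val with hl₁
    set l₂ := (List.ofFn σ).drop ((constVar c).val + 1)
    have hsplit : List.ofFn σ = l₁ ++ σ (constVar c) :: l₂ := by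
      have hlt : (constVar c).val < (List.ofFn σ).length := by simp
      have := List.take_append_drop (constVar c).val (List.ofFn σ)
      rw [List.drop_eq_getElem_cons hlt, List.getElem_ofFn] at this
      exact this.symm
    have hlen : l₁.length = (constVar c).val := by
      simp [hl₁, (constVar c).isLt.le]
    have h₁ := ih (b := b && decide (σ (constVar c) = constOf c.rel)) (by
      refine Eq.mp ?_ h
      congr 3
      rw [Bool.and_assoc, ← Bool.decide_and]
      congr 2
      simp [or_imp, forall_and, and_comm])
    rw [hsplit] at h₁ ⊢
    have h₂ := run_checkAll_strokes (l₁ := l₁) (l' := []) (by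
      rw [List.append_nil]
      exact run_checkAll_const h₁)
    have htoks : ((cs ++ [c]).flatMap constTokens).reverse ++ u =
        List.replicate l₁.length none ++ some (.const (some (constOf c.rel))) ::
          ((cs.flatMap constTokens).reverse ++ u) := by
      simp [constTokens, hlen]
    rw [htoks]
    refine h₂.congr ?_ rfl rfl
    have := (constVar c).isLt
    simp only [List.length_append, List.length_singleton, add_mul]
    omega

theorem run_checkAll_skip (u : List (Option (Token Γ)))
    (hu : ∀ a ∈ u, (∃ b, a = litTok b) ∨ a = some .argSep) (v : SReg D) (l : List D) :
    Run checkAll v (sStacks [] u l [] []) (2 * u.length + 1) v (sStacks [] [] l [] []) := by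
  induction u with
  | nil => exact (Run.forEach_nil rfl).congr (by simp) rfl rfl
  | cons a u ih =>
    refine (Run.forEach_cons (k := SStack.toks) (a := a) (l := u) (t := 1) rfl ?_
      (ih fun a ha => hu a (by simp [ha]))).congr ?_ rfl rfl
    · rw [supdate_toks]
      obtain ⟨b, rfl⟩ | rfl := hu a (by simp)
      · exact Run.skip
      · exact Run.skip
    · simp only [List.length_cons]
      omega

theorem mem_termTokens {n : ℕ} (t : CSPTerm Γ n) :
    ∀ a ∈ termTokens t, (∃ b, a = litTok b) ∨ a = some .argSep := by
  intro a ha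
  simp only [termTokens, argTokens, List.mem_cons, List.mem_append, List.mem_map,
    List.mem_flatMap, List.mem_replicate] at ha
  obtain rfl | ⟨b, -, rfl⟩ | rfl | ⟨b, -, rfl⟩ | ⟨_, _, rfl | ⟨-, rfl⟩⟩ := ha
  all_goals first | exact .inl ⟨_, rfl⟩ | exact .inr rfl

open scoped Classical in
theorem run_checkAll (I : CSPInst Γ (constRels D)) (σ : Fin I.numVars → D) (q : Phase)
    (g : D → D) {B : ℕ} (hn : I.numVars ≤ B) (hI : I.enc.length ≤ B) :
    Run checkAll (q, g, true)
      (sStacks [] (tokenize .head I.enc).reverse (List.ofFn σ) [] [])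
      (B * (5 * B + 5) + (2 * B + 1)) (q, g, decide (I.IsSol σ))
      (sStacks [] [] (List.ofFn σ) [] []) := by
  have hlen := length_tokenize .head I.enc
  rw [tokenize_enc] at hlen ⊢
  rw [← List.append_assoc, List.reverse_append] at *
  have h := run_checkAll_constraints σ I.constraints (b := true) (run_checkAll_skip
    (List.replicate I.numVars (litTok .tick) ++ I.terms.flatMap termTokens).reverse (by
      intro a ha
      rw [List.mem_reverse, List.mem_append, List.mem_replicate, List.mem_flatMap] at ha
      obtain ⟨-, rfl⟩ | ⟨t, -, ha⟩ := ha
      · exact .inl ⟨_, rfl⟩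
      · exact mem_termTokens t a ha)
    (q, g, true && decide (∀ c ∈ I.constraints, σ (constVar c) = constOf c.rel)) (List.ofFn σ))
  -- Every constraint contributes at least one token, so the length of the input bounds the number
  -- of constraints.
  have hcs : I.constraints.length ≤
      (I.constraints.flatMap (constTokens (Γ := Γ))).length := by
    generalize I.constraints = cs
    induction cs with
    | nil => simp
    | cons c cs ih =>
      simp only [List.flatMap_cons, List.length_append, constTokens, List.length_cons] at ih ⊢
      omega
  rw [List.length_append] at hlen
  refine h.congr ?_ ?_ rfl
  · rw [List.length_reverse]
    gcongr <;> omega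
  · congr 2
    rw [Bool.true_and]
    exact decide_eq_decide.2 isSol_iff.symm

/-- Write the answer. -/
def writeAnswer : StackProg (SAlph Γ) (SReg D) :=
  case fun v => if v.2.2 then seq (move .vals .tmp id) (move .tmp .out some)
    else seq (clear .vals) (push .out none)

theorem run_writeAnswer (q : Phase) (g : D → D) (b : Bool) (l : List D) {B : ℕ}
    (hl : l.length ≤ B) :
    Run (writeAnswer (Γ := Γ)) (q, g, b) (sStacks [] [] l [] []) (4 * B + 3) (q, g, b)
      (sStacks [] [] [] [] (if b then l.map some else [none])) := by
  cases b with
  | true =>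
    have h := (run_move_vals_tmp (Γ := Γ) (q, g, true) [] l [] id).seq
      (run_move_tmp_out (q, g, true) [] [] _)
    refine (Run.case (by simpa using h)).congr ?_ rfl (by simp)
    simp
    omega
  | false =>
    have h := (run_clear_vals (Γ := Γ) (q, g, false) [] l []).seq
      (Run.push.congr (S'' := sStacks [] [] [] [] [none]) le_rfl rfl
        (supdate_out _ _ _ _ _ [none]))
    refine (Run.case (by simpa using h)).congr ?_ rfl (by simp)
    omega

variable [Finite D]

/-- The program that recovers solutions. -/
noncomputable def recoverProg : StackProg (SAlph Γ) (SReg D) :=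
  seq readPair (seq (load fun v => (.head, v.2)) (seq (move .tmp .vals id)
    (seq (loadElems (List.ofFn idx.symm)) (seq (case fun v => move .vals .tmp (invOrSelf v.2.1))
      (seq (move .tmp .vals id) (seq checkAll (seq writeAnswer
        (load fun _ => (.head, id, true)))))))))

theorem run_recoverProg (I : CSPInst Γ (constRels D)) (s : Fin (Nat.card D + I.numVars) → D)
    {B : ℕ} (hB : I.enc.length + (Nat.card D + I.numVars) ≤ B) :
    Run recoverProg (.head, id, true)
      (sStacks (I.enc.map Sum.inl ++ (List.ofFn s).map Sum.inr) [] [] [] [])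
      (5 * B + (2 * B + 1) + (1 + (2 * B + 1 + (2 * B + 1 + (2 * B + 1 + 1 + (2 * B + 1 +
        (B * (5 * B + 5) + (2 * B + 1) + (4 * B + 3 + 1))))))))
      (.head, id, true)
      (sStacks [] [] [] [] ((recoverSol I s).elim [none] fun σ => (List.ofFn σ).map some)) := by
  classical
  obtain ⟨q, hread⟩ := run_readPair I.enc (List.ofFn s) .head (id, true) []
  rw [List.append_nil] at hread
  set u := (tokenize .head I.enc).reverse
  set g : D → D := fun e => s (Fin.castAdd _ (idx e)) with hg
  have hmove := run_move_tmp_vals (.head, id, true) u [] (List.ofFn s).reverse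
  rw [List.reverse_reverse, List.append_nil, List.length_reverse] at hmove
  have hsplit : List.ofFn s = (List.ofFn idx.symm).map g ++
      List.ofFn fun i : Fin I.numVars => s (Fin.natAdd _ i) := by
    rw [List.ofFn_add, List.map_ofFn]
    congr 2
    funext i
    simp only [hg, comp_apply, Equiv.apply_symm_apply]
    rfl
  have hload := run_loadElems g (List.ofFn idx.symm) .head id true u
    (List.ofFn fun i : Fin I.numVars => s (Fin.natAdd _ i))
  rw [← hsplit, List.length_ofFn] at hload
  -- Every element of D is listed, so nothing of the initial map `id` remains in the register.
  have hg' : (fun e => if e ∈ List.ofFn (idx (D := D)).symm then g e else id e) = g := by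
    funext e
    rw [if_pos (List.mem_ofFn.2 ⟨idx e, by simp⟩)]
  rw [hg'] at hload
  have hinv : Run (case fun v => move .vals .tmp (invOrSelf v.2.1)) (Phase.head, g, true)
      (sStacks [] u (List.ofFn fun i : Fin I.numVars => s (Fin.natAdd _ i)) [] [])
      (2 * I.numVars + 1 + 1) (.head, g, true)
      (sStacks [] u [] (List.ofFn (pullBack I.numVars s)).reverse []) := by
    refine (Run.case (run_move_vals_tmp (Γ := Γ) (.head, g, true) u _ _ (invOrSelf g))).congr
      (by simp) rfl ?_
    rw [List.append_nil, List.map_ofFn]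
    rfl
  have hmove' := run_move_tmp_vals (.head, g, true) u []
    (List.ofFn (pullBack I.numVars s)).reverse
  rw [List.reverse_reverse, List.append_nil, List.length_reverse, List.length_ofFn] at hmove'
  have hcheck := run_checkAll I (pullBack I.numVars s) .head g (B := B) (by omega) (by omega)
  have hanswer := run_writeAnswer (Γ := Γ) .head g (decide (I.IsSol (pullBack I.numVars s)))
    (List.ofFn (pullBack I.numVars s)) (B := B) (by rw [List.length_ofFn]; omega)
  rw [List.length_ofFn] at hread hmove
  refine (hread.seq (Run.load.seq (hmove.seq (hload.seq (hinv.seq (hmove'.seq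
    (hcheck.seq (hanswer.seq Run.load)))))))).congr ?_ rfl ?_
  · gcongr <;> omega
  · by_cases h : I.IsSol (pullBack I.numVars s) <;> simp [recoverSol, h]

/-- The answer obtained from a solution of the reduced instance is computable in polynomial
time. -/
theorem polyTimeComputable_recoverSol [Finite Γ] :
    PolyTimeComputable
      (MinProblem.encPair (MinCSPWith Γ (constRels D)) (MinCSP Γ) reduceInst)
      (MinCSPWith Γ (constRels D)).encAnswer
      (fun p => ⟨p.1, recoverSol p.1 p.2⟩) := by
  let X : Polynomial ℕ := Polynomial.X
  refine polyTimeComputable (recoverProg (Γ := Γ)) SStack.inp SStack.out (Phase.head, id, true)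
    _ _ _ (5 * X + (2 * X + 1) + (1 + (2 * X + 1 + (2 * X + 1 + (2 * X + 1 + 1 + (2 * X + 1 +
        (X * (5 * X + 5) + (2 * X + 1) + (4 * X + 3 + 1)))))))) fun p => ?_
  obtain ⟨I, s⟩ := p
  change Fin (Nat.card D + I.numVars) → D at s
  have hinit : update (β := fun k => List (SAlph Γ k)) (fun _ => []) .inp
      (MinProblem.encPair (MinCSPWith Γ (constRels D)) (MinCSP Γ) reduceInst ⟨I, s⟩) =
        sStacks (I.enc.map Sum.inl ++ (List.ofFn s).map Sum.inr) [] [] [] [] := by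
    funext k; cases k <;> rfl
  have hfinal : update (β := fun k => List (SAlph Γ k)) (fun _ => []) .out
      ((MinCSPWith Γ (constRels D)).encAnswer ⟨I, recoverSol I s⟩) =
        sStacks [] [] [] [] ((recoverSol I s).elim [none] fun σ => (List.ofFn σ).map some) := by
    funext k
    cases k <;> try rfl
    cases h : recoverSol I s <;> rfl
  have hlen : (MinProblem.encPair (MinCSPWith Γ (constRels D)) (MinCSP Γ) reduceInst
      ⟨I, s⟩).length = I.enc.length + (Nat.card D + I.numVars) := by
    change (I.enc.map Sum.inl ++ (List.ofFn s).map Sum.inr).length = _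
    simp
  refine Eq.mp ?_ (run_recoverProg I s hlen.ge)
  simp only [X, Polynomial.eval_add, Polynomial.eval_mul, Polynomial.eval_X,
    Polynomial.eval_one, Polynomial.eval_ofNat]
  rw [hinit, hfinal]
  rfl

end CoreReduction

theorem proposition5 {D : Type} [Finite D] (Γ : Set (CostFn D)) (hΓ : Γ.Finite)
    (hcore : IsCore Γ) :
    MinProblem.PolyTimeReducible (MinCSPWith Γ (constRels D)) (MinCSP Γ) := by
  have : Finite Γ := hΓ.to_subtype
  refine ⟨CoreReduction.reduceInst, fun I s => CoreReduction.recoverSol I s,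
    CoreReduction.polyTimeComputable_reduceInst,
    CoreReduction.polyTimeComputable_recoverSol, fun I => ⟨?_, fun s hs => ⟨?_, ?_⟩⟩⟩
  · rintro ⟨σ, -⟩
    exact ⟨Fin.append CoreReduction.idx.symm σ,
      CoreReduction.isSol_of_constraints_eq_nil (I := CoreReduction.reduceInst I) rfl _⟩
  · intro hsat
    have h := CoreReduction.reduction_correct hcore (I := I) (s := s)
      (fun s' => hs.2 s' (CoreReduction.isSol_of_constraints_eq_nil rfl s')) hsat
    exact ⟨CoreReduction.pullBack _ s, if_pos h.1, h⟩
  · intro hunsat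
    -- An assignment is returned only after it has been checked to be a solution.
    exact if_neg fun h => hunsat ⟨_, h⟩
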